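/- **Hybrid rearrangement lemma.** Let $\ell>0$, $\mu>0$ and $2<p<6$. Let $\mathcal G$ be the metric graph consisting of a straight line $\mathbb R$ and a pendant edge $I=[0,\ell]$ whose endpoint $0$ is attached to the origin of the line. A function $u$ on $\mathcal G$ is identified with a pair $u=(\phi,\psi)$, $\phi:\mathbb R\to\mathbb R$, $\psi:I\to\mathbb R$. Let $H^1(\mathcal G)$ be the set of continuous $u=(\phi,\psi)$ with $\phi\in H^1(\mathbb R)$, $\psi\in H^1(I)$ and $\phi(0)=\psi(0)$, and let $H^1_\mu(\mathcal G)$ be the set of those with $\int_{\mathbb R}|\phi|^2\,dx+\int_0^\ell|\psi|^2\,dx=\mu$. For $u\in H^1(\mathcal G)$ let $$E(u,\mathcal G)=\frac12\Bigl(\int_{\mathbb R}|\phi'|^2\,dx+\int_0^\ell|\psi'|^2\,dx\Bigr)-\frac1p\Bigl(\int_{\mathbb R}|\phi|^p\,dx+\int_0^\ell|\psi|^p\,dx\Bigr),$$ and write $\operatorname{meas}$ for the total length of a subset of $\mathcal G$. Let $u=(\phi,\psi)\in H^1_\mu(\mathcal G)$ with $u>0$ on $\mathcal G$ and $\operatorname{meas}(\{u=t\})=0$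 for every $t>0$. Then there exists $\widetilde u=(\widetilde\phi,\widetilde\psi)\in H^1_\mu(\mathcal G)$ such that: (i) $\widetilde\phi$ is even and (strictly) radially decreasing; (ii) $\widetilde\psi$ is (strictly) increasing on $I$, and $\min\widetilde\psi=\widetilde\psi(0)=\widetilde\phi(0)=\max\widetilde\phi$; (iii) $E(\widetilde u,\mathcal G)\le E(u,\mathcal G)$, and if equality occurs, then $\psi$ is (strictly) increasing on $[0,\ell]$ and $\min\psi=\max\phi$. Moreover, $\widetilde u$ can be taken to be a rearrangement of $u$ in the following sense: there is $\tau>0$ with $\operatorname{meas}(\{u>\tau\})=\ell$ such that $\operatorname{meas}(\{x\in I:\widetilde\psi(x)>t\})=\operatorname{meas}(\{u>t\})$ for every $t\ge\tau$, and $\operatorname{meas}(\{x\in\mathbb R:\widetilde\phi(x)>t\})=\operatorname{meas}(\{t<u\le\tau\})$ for every $0<t<\tau$. -/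

import Mathlib

open MeasureTheory Set
open scoped ContDiff ENNReal

/-- `g` is the weak (distributional) derivative of `f` on the open set `U ⊆ ℝ`. -/
structure IsWeakDeriv (U : Set ℝ) (f g : ℝ → ℝ) : Prop where
  locallyIntegrableOn : LocallyIntegrableOn f U
  locallyIntegrableOn_deriv : LocallyIntegrableOn g U
  integral_eq : ∀ η : ℝ → ℝ, ContDiff ℝ ∞ η → HasCompactSupport η → tsupport η ⊆ U →
    ∫ x in U, f x * deriv η x = -∫ x in U, g x * η x

/-- Weak derivatives are unique up to null sets. -/
theorem IsWeakDeriv.ae_eq {U : Set ℝ} (hU : IsOpen U) {f g₁ g₂ : ℝ → ℝ}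
    (h₁ : IsWeakDeriv U f g₁) (h₂ : IsWeakDeriv U f g₂) : g₁ =ᵐ[volume.restrict U] g₂ := by
  have key : ∀ {g : ℝ → ℝ}, LocallyIntegrableOn g U → ∀ η : ℝ → ℝ, ContDiff ℝ ∞ η →
      HasCompactSupport η → tsupport η ⊆ U → Integrable (fun x => η x • g x) volume := by
    intro g hg η hη hc hs
    have hK : IsCompact (tsupport η) := hc
    have h := (hg.integrableOn_compact_subset hs hK).continuousOn_smul
      hη.continuous.continuousOn hK
    refine (integrableOn_iff_integrable_of_support_subset ?_).1 h
    intro x hx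
    apply subset_tsupport η
    intro h0
    exact hx (by simp [h0])
  have h := hU.ae_eq_zero_of_integral_contDiff_smul_eq_zero (μ := volume)
    (f := fun x => g₁ x - g₂ x)
    (h₁.locallyIntegrableOn_deriv.sub h₂.locallyIntegrableOn_deriv) ?_
  · rw [Filter.EventuallyEq, ae_restrict_iff' hU.measurableSet]
    filter_upwards [h] with x hx hxU
    exact sub_eq_zero.1 (hx hxU)
  · intro η hη hc hs
    have e₁ := key h₁.locallyIntegrableOn_deriv η hη hc hs
    have e₂ := key h₂.locallyIntegrableOn_deriv η hη hc hs
    have hz : ∀ (g : ℝ → ℝ), ∫ x in U, g x * η x = ∫ x, η x • g x := by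
      intro g
      rw [setIntegral_eq_integral_of_forall_compl_eq_zero]
      · simp [mul_comm]
      · intro x hx
        have : η x = 0 := image_eq_zero_of_notMem_tsupport fun h => hx (hs h)
        simp [this]
    have h3 := (h₁.integral_eq η hη hc hs).symm.trans (h₂.integral_eq η hη hc hs)
    rw [hz, hz] at h3
    simp only [smul_sub]
    rw [integral_sub e₁ e₂]
    linarith

open Classical in
/-- A representative of the weak derivative of `f` on `U` (zero if there is none). -/
noncomputable def weakDeriv (U : Set ℝ) (f : ℝ → ℝ) : ℝ → ℝ :=
  if h : ∃ g, IsWeakDeriv U f g then h.choose else 0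

theorem IsWeakDeriv.weakDeriv_ae_eq {U : Set ℝ} (hU : IsOpen U) {f g : ℝ → ℝ}
    (h : IsWeakDeriv U f g) : weakDeriv U f =ᵐ[volume.restrict U] g := by
  have hex : ∃ g, IsWeakDeriv U f g := ⟨g, h⟩
  rw [weakDeriv, dif_pos hex]
  exact hex.choose_spec.ae_eq hU h

/-- The Sobolev space `H¹(U)`: `f ∈ L²(U)` with a weak derivative in `L²(U)`. -/
def MemH1 (U : Set ℝ) (f : ℝ → ℝ) : Prop :=
  MemLp f 2 (volume.restrict U) ∧
    ∃ g, IsWeakDeriv U f g ∧ MemLp g 2 (volume.restrict U)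

/-- A function `u = (φ, ψ)` on the metric graph made of a straight line `ℝ` (two half-lines) and
a pendant edge `[0, ℓ]` whose endpoint `0` is glued to the point `0` of the line. Only the values
of `pendant` on `[0, ℓ]` are ever used. -/
structure PendantFun where
  line : ℝ → ℝ
  pendant : ℝ → ℝ

namespace PendantFun

/-- Membership in `H¹` of the graph: continuous on the graph, and `H¹` on the line
and on the pendant. -/
structure InH1 (ℓ : ℝ) (u : PendantFun) : Prop where
  continuous_line : Continuous u.line
  continuousOn_pendant : ContinuousOn u.pendant (Icc 0 ℓ)
  junction : u.line 0 = u.pendant 0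
  memH1_line : MemH1 univ u.line
  memH1_pendant : MemH1 (Ioo 0 ℓ) u.pendant

/-- The mass, i.e. the squared `L²` norm on the graph. -/
noncomputable def mass (ℓ : ℝ) (u : PendantFun) : ℝ :=
  (∫ x, |u.line x| ^ 2) + ∫ x in Ioo 0 ℓ, |u.pendant x| ^ 2

/-- `u ∈ H¹_μ`. -/
def InH1Mass (ℓ μ : ℝ) (u : PendantFun) : Prop :=
  u.InH1 ℓ ∧ u.mass ℓ = μ

/-- The NLS energy `½ ‖u'‖²_{L²} - (1/p) ‖u‖ᵖ_{Lᵖ}` on the graph. -/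
noncomputable def energy (p ℓ : ℝ) (u : PendantFun) : ℝ :=
  1 / 2 * ((∫ x, |weakDeriv univ u.line x| ^ 2) +
      ∫ x in Ioo 0 ℓ, |weakDeriv (Ioo 0 ℓ) u.pendant x| ^ 2) -
    1 / p * ((∫ x, |u.line x| ^ p) + ∫ x in Ioo 0 ℓ, |u.pendant x| ^ p)

/-- The measure of `{u ∈ S}` (total length of the corresponding part of the graph). -/
noncomputable def meas (ℓ : ℝ) (u : PendantFun) (S : Set ℝ) : ℝ≥0∞ :=
  volume {x | u.line x ∈ S} + volume {x ∈ Icc 0 ℓ | u.pendant x ∈ S}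

/-- `u > 0` on the graph. -/
def Pos (ℓ : ℝ) (u : PendantFun) : Prop :=
  (∀ x, 0 < u.line x) ∧ ∀ x ∈ Icc 0 ℓ, 0 < u.pendant x

end PendantFun

/-! This is a Pólya–Szegő inequality obtained by counting crossings, with increment estimates in
place of the coarea formula. On a strip {t₁ < u < t₂}, Cauchy–Schwarz bounds (∫|u'|)² by length
times energy, and ∫|u'| ≥ k(t₂ - t₁) as soon as k disjoint paths cross the strip; the outcome is
`StripBound`. Connectedness of the graph gives k = 1 for positive strips below sup u. If the line
takes values above every level below t₂, then k = 2, because u drops below any positive level on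
both sides of any point of the line.

The bound with k = 1 makes the length of {u > t} strictly decreasing in t up to sup u, and null
level sets make it continuous, so it has an inverse F on [0, ∞), the decreasing rearrangement. Put τ
= F ℓ, so that {u > τ} has length ℓ. The competitor is F (ℓ - x) on the pendant and F (ℓ + 2|x|) on
the line. A level below τ is exceeded somewhere on the line, since otherwise its superlevel set
would lie in the pendant and have length at most ℓ. Hence k = 2 below τ, which pays exactly for the
two symmetric branches, while the single monotone branch above τ needs only k = 1.

In the length variable the strip bounds read (f x - f y)² ≤ (y - x)(Γ y - Γ x), with Γ a monotone
energy function. Such a bound (`SqIncrementBound`) makes f the integral of its derivative and gives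
∫ f'² ≤ Γ b - Γ a. The L² and Lᵖ terms agree by the layer-cake formula.

For equality, a strip above τ all of whose substrips satisfy the bound with k = 2 makes the pendant
estimate strict. If there is no such strip, then u ≤ τ on the line, u ≥ τ on the pendant, and u is
nondecreasing on the pendant; null level sets make it strictly increasing. -/

/-! ### Weak derivatives and primitives in one dimension. -/

theorem setIntegral_mul_eq_integral_of_tsupport_subset {U : Set ℝ} {η : ℝ → ℝ}
    (hs : tsupport η ⊆ U) (f : ℝ → ℝ) : ∫ x in U, f x * η x = ∫ x, f x * η x := by
  refine setIntegral_eq_integral_of_forall_compl_eq_zero fun x hx => ?_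
  rw [image_eq_zero_of_notMem_tsupport fun h => hx (hs h), mul_zero]

theorem tsupport_deriv_subset_of_subset {U : Set ℝ} {η : ℝ → ℝ} (hs : tsupport η ⊆ U) :
    tsupport (deriv η) ⊆ U :=
  (closure_minimal (support_deriv_subset) (isClosed_tsupport η)).trans hs

theorem exists_tsupport_subset_Ioo {η : ℝ → ℝ} (hc : HasCompactSupport η) :
    ∃ a b : ℝ, a ≤ b ∧ tsupport η ⊆ Ioo a b := by
  obtain ⟨R, hR⟩ := hc.isCompact.isBounded.exists_pos_norm_lt
  exact ⟨-R, R, by linarith [hR.1], fun x hx => abs_lt.1 (hR.2 x hx)⟩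

theorem integral_eq_intervalIntegral_of_tsupport_subset {η : ℝ → ℝ} {a b : ℝ} (hab : a ≤ b)
    (hs : tsupport η ⊆ Ioo a b) (f : ℝ → ℝ) : ∫ x, f x * η x = ∫ x in a..b, f x * η x := by
  rw [intervalIntegral.integral_of_le hab, setIntegral_mul_eq_integral_of_tsupport_subset
    (hs.trans Ioo_subset_Ioc_self)]

/-- A primitive of a locally integrable function is weakly differentiable. -/
theorem isWeakDeriv_of_eq_primitive {U : Set ℝ} (hU : IsOpen U) {f g : ℝ → ℝ} {c : ℝ}
    (hg : LocallyIntegrable g) (h : ∀ x ∈ U, f x = c + ∫ t in (0 : ℝ)..x, g t) :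
    IsWeakDeriv U f g := by
  have hgi : ∀ a b, IntervalIntegrable g volume a b := fun a b =>
    (hg.integrableOn_isCompact isCompact_uIcc).intervalIntegrable
  have hcont : Continuous fun x => c + ∫ t in (0 : ℝ)..x, g t :=
    continuous_const.add (intervalIntegral.continuous_primitive hgi 0)
  refine ⟨(hcont.continuousOn.congr h).locallyIntegrableOn hU.measurableSet,
    hg.locallyIntegrableOn U, fun η hη hc hs => ?_⟩
  have e₁ : ∫ x in U, f x * deriv η x = ∫ x in U, (c + ∫ t in (0 : ℝ)..x, g t) * deriv η x :=
    setIntegral_congr_fun hU.measurableSet fun x hx => by simp only [h x hx]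
  rw [e₁, setIntegral_mul_eq_integral_of_tsupport_subset (tsupport_deriv_subset_of_subset hs),
    setIntegral_mul_eq_integral_of_tsupport_subset hs]
  obtain ⟨a, b, hab, hsub⟩ := exists_tsupport_subset_Ioo hc
  rw [integral_eq_intervalIntegral_of_tsupport_subset hab (tsupport_deriv_subset_of_subset hsub),
    integral_eq_intervalIntegral_of_tsupport_subset hab hsub]
  have hac : AbsolutelyContinuousOnInterval (fun x => ∫ t in a..x, g t) a b :=
    (hgi a b).absolutelyContinuousOnInterval_intervalIntegral left_mem_uIcc
  -- Absolute continuity on [a, b] is available for the primitive based at a, so the base point is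
  -- moved from 0 to a.
  have hac' : AbsolutelyContinuousOnInterval (fun x => c + ∫ t in (0 : ℝ)..x, g t) a b := by
    have hconst : AbsolutelyContinuousOnInterval (fun _ : ℝ => c + ∫ t in (0 : ℝ)..a, g t) a b :=
      (contDiffOn_const (n := 1)).absolutelyContinuousOnInterval
    have e : (fun x => c + ∫ t in (0 : ℝ)..x, g t) =
        (fun _ : ℝ => c + ∫ t in (0 : ℝ)..a, g t) + fun x => ∫ t in a..x, g t := by
      funext x
      simp only [Pi.add_apply]
      rw [add_assoc, intervalIntegral.integral_add_adjacent_intervals (hgi _ _) (hgi _ _)]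
    rw [e]
    exact hconst.add hac
  have hηac : AbsolutelyContinuousOnInterval η a b :=
    (hη.of_le (by norm_num)).contDiffOn.absolutelyContinuousOnInterval
  rw [hac'.integral_mul_deriv_eq_deriv_mul hηac,
    image_eq_zero_of_notMem_tsupport (fun h => (hsub h).1.ne rfl),
    image_eq_zero_of_notMem_tsupport (fun h => (hsub h).2.ne rfl)]
  simp only [mul_zero, sub_zero, zero_sub, neg_inj]
  refine intervalIntegral.integral_congr_ae ?_
  filter_upwards [(hgi a b).ae_hasDerivAt_integral] with x hx hxab
  have := (hx (uIoc_subset_uIcc hxab) a left_mem_uIcc).const_add (c + ∫ t in (0 : ℝ)..a, g t)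
  have e : (fun x => c + ∫ t in (0 : ℝ)..x, g t) =
      fun x => (c + ∫ t in (0 : ℝ)..a, g t) + ∫ t in a..x, g t := by
    funext y
    rw [add_assoc, intervalIntegral.integral_add_adjacent_intervals (hgi _ _) (hgi _ _)]
  rw [e, this.deriv]

/-- A test function with vanishing integral is the derivative of a test function. -/
theorem exists_testFunction_deriv_eq {U : Set ℝ} (hconn : U.OrdConnected) (hne : U.Nonempty)
    {θ : ℝ → ℝ} (hθ : ContDiff ℝ ∞ θ) (hc : HasCompactSupport θ) (hs : tsupport θ ⊆ U)
    (hint : ∫ x, θ x = 0) :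
    ∃ η : ℝ → ℝ, ContDiff ℝ ∞ η ∧ HasCompactSupport η ∧ tsupport η ⊆ U ∧ deriv η = θ := by
  obtain ⟨x₀, hx₀⟩ := hne
  -- Adding x₀ keeps the compact set nonempty when θ vanishes; its hull [a, b] stays in U by
  -- order-connectedness.
  have hK : IsCompact (tsupport θ ∪ {x₀}) := hc.isCompact.union isCompact_singleton
  have hKU : tsupport θ ∪ {x₀} ⊆ U := union_subset hs (by simpa using hx₀)
  have hKne : (tsupport θ ∪ {x₀}).Nonempty := ⟨x₀, by simp⟩
  obtain ⟨a, ha, ha'⟩ := hK.exists_isLeast hKne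
  obtain ⟨b, hb, hb'⟩ := hK.exists_isGreatest hKne
  have hIU : Icc a b ⊆ U := hconn.out (hKU ha) (hKU hb)
  have hzero : ∀ x, x ∉ Icc a b → θ x = 0 := fun x hx =>
    image_eq_zero_of_notMem_tsupport fun h => hx ⟨ha' (Or.inl h), hb' (Or.inl h)⟩
  have hab : a ≤ b := ha' hb
  have hab0 : ∫ t in a..b, θ t = 0 := by
    rw [← hint, intervalIntegral.integral_of_le hab, ← integral_Icc_eq_integral_Ioc,
      setIntegral_eq_integral_of_forall_compl_eq_zero hzero]
  have hderiv : ∀ x, HasDerivAt (fun x => ∫ t in a..x, θ t) (θ x) x := fun x =>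
    intervalIntegral.integral_hasDerivAt_right (hθ.continuous.intervalIntegrable _ _)
      hθ.continuous.stronglyMeasurable.stronglyMeasurableAtFilter hθ.continuous.continuousAt
  have hd : deriv (fun x => ∫ t in a..x, θ t) = θ := funext fun x => (hderiv x).deriv
  have hout : ∀ x, x ∉ Icc a b → ∫ t in a..x, θ t = 0 := by
    intro x hx
    rcases lt_or_ge x a with h | h
    · rw [intervalIntegral.integral_symm, intervalIntegral.integral_zero_ae, neg_zero]
      filter_upwards [compl_mem_ae_iff.2 (measure_singleton a)] with t ht htx
      rw [uIoc_of_le h.le] at htx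
      exact hzero t fun h' => ht (le_antisymm htx.2 h'.1)
    · have hbx : b < x := not_le.1 fun h' => hx ⟨h, h'⟩
      rw [← intervalIntegral.integral_add_adjacent_intervals (b := b)
        (hθ.continuous.intervalIntegrable _ _) (hθ.continuous.intervalIntegrable _ _), hab0,
        zero_add, intervalIntegral.integral_zero_ae]
      refine Filter.Eventually.of_forall fun t ht => ?_
      rw [uIoc_of_le hbx.le] at ht
      exact hzero t fun h' => ht.1.not_ge h'.2
  refine ⟨fun x => ∫ t in a..x, θ t, ?_, HasCompactSupport.intro isCompact_Icc hout, ?_, hd⟩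
  · rw [contDiff_infty_iff_deriv, hd]
    exact ⟨fun x => (hderiv x).differentiableAt, hθ⟩
  · refine (closure_minimal (fun x hx => ?_) isClosed_Icc).trans hIU
    by_contra h
    exact hx (hout x h)

/-- A function with vanishing weak derivative is constant. -/
theorem exists_ae_eq_const_of_integral_mul_deriv_eq_zero {U : Set ℝ} (hU : IsOpen U)
    (hconn : U.OrdConnected) (hne : U.Nonempty) {w : ℝ → ℝ} (hw : LocallyIntegrableOn w U)
    (h : ∀ η : ℝ → ℝ, ContDiff ℝ ∞ η → HasCompactSupport η → tsupport η ⊆ U →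
      ∫ x in U, w x * deriv η x = 0) :
    ∃ c : ℝ, ∀ᵐ x, x ∈ U → w x = c := by
  obtain ⟨x₀, hx₀⟩ := hne
  obtain ⟨ε, hε, hball⟩ := Metric.isOpen_iff.1 hU x₀ hx₀
  let B : ContDiffBump x₀ := ⟨ε / 4, ε / 2, by positivity, by linarith⟩
  let θ₀ : ℝ → ℝ := B.normed volume
  have hθ₀ : ContDiff ℝ ∞ θ₀ := B.contDiff_normed
  have hc₀ : HasCompactSupport θ₀ := B.hasCompactSupport_normed
  have hs₀ : tsupport θ₀ ⊆ U := by
    rw [show tsupport θ₀ = _ from B.tsupport_normed_eq]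
    exact (Metric.closedBall_subset_ball (show ε / 2 < ε by linarith)).trans hball
  have hi₀ : ∫ x, θ₀ x = 1 := B.integral_normed
  have hint : ∀ {v : ℝ → ℝ}, LocallyIntegrableOn v U → ∀ η : ℝ → ℝ, ContDiff ℝ ∞ η →
      HasCompactSupport η → tsupport η ⊆ U → Integrable (fun x => v x * η x) volume := by
    intro v hv η hη hc hs
    have h := (hv.integrableOn_compact_subset hs hc).mul_continuousOn
      hη.continuous.continuousOn hc
    refine (integrableOn_iff_integrable_of_support_subset fun x hx => ?_).1 h
    exact subset_tsupport η fun h0 => hx (by simp [h0])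
  -- The constant is the mean of w against a bump of mass 1. For any test function θ of integral m,
  -- θ - m θ₀ has integral zero, hence is the derivative of a test function and is annihilated by w.
  refine ⟨∫ x, w x * θ₀ x, ?_⟩
  set c := ∫ x, w x * θ₀ x with hcdef
  have hcl : LocallyIntegrableOn (fun _ : ℝ => c) U :=
    (locallyIntegrable_const c).locallyIntegrableOn U
  have := hU.ae_eq_zero_of_integral_contDiff_smul_eq_zero (μ := volume)
    (f := fun x => w x - c) (hw.sub hcl) ?_
  · filter_upwards [this] with x hx hxU using sub_eq_zero.1 (hx hxU)
  intro θ hθ hc hs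
  set m := ∫ x, θ x with hm
  have hθi : Integrable θ := hθ.continuous.integrable_of_hasCompactSupport hc
  have hθ₀i : Integrable θ₀ := hθ₀.continuous.integrable_of_hasCompactSupport hc₀
  have hsub : tsupport (fun x => θ x - m * θ₀ x) ⊆ U := by
    refine (closure_minimal (fun x hx => ?_)
      ((isClosed_tsupport θ).union (isClosed_tsupport θ₀))).trans (union_subset hs hs₀)
    by_contra hx'
    rw [mem_union, not_or] at hx'
    exact hx (by simp [image_eq_zero_of_notMem_tsupport hx'.1,
      image_eq_zero_of_notMem_tsupport hx'.2])
  obtain ⟨η, hη, hηc, hηs, hηd⟩ := exists_testFunction_deriv_eq hconn ⟨x₀, hx₀⟩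
    (θ := fun x => θ x - m * θ₀ x) (hθ.sub (contDiff_const.mul hθ₀))
    (hc.sub hc₀.mul_left) hsub (by
      rw [integral_sub hθi (hθ₀i.const_mul m), integral_const_mul, hi₀, mul_one, sub_self])
  have h0 := h η hη hηc hηs
  rw [hηd, setIntegral_mul_eq_integral_of_tsupport_subset hsub] at h0
  have e₁ := hint hw θ hθ hc hs
  have e₂ := hint hw θ₀ hθ₀ hc₀ hs₀
  have e₃ : ∫ x, w x * (θ x - m * θ₀ x) = (∫ x, w x * θ x) - m * c := by
    rw [hcdef, ← integral_const_mul, ← integral_sub e₁ (e₂.const_mul m)]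
    exact integral_congr_ae (Filter.Eventually.of_forall fun x => by ring)
  have e₄ : ∫ x, θ x • (w x - c) = (∫ x, w x * θ x) - m * c := by
    rw [hm, mul_comm, ← integral_const_mul, ← integral_sub e₁ (hθi.const_mul c)]
    exact integral_congr_ae (Filter.Eventually.of_forall fun x => by
      simp only [smul_eq_mul]; ring)
  rw [e₄, ← e₃, h0]

/-- A continuous weakly differentiable function is a primitive of its weak derivative. -/
theorem IsWeakDeriv.exists_eq_primitive {U : Set ℝ} (hU : IsOpen U) (hconn : U.OrdConnected)
    (hne : U.Nonempty) {f g : ℝ → ℝ} (h : IsWeakDeriv U f g) (hg : LocallyIntegrable g)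
    (hf : ContinuousOn f (closure U)) :
    ∃ c : ℝ, ∀ x ∈ closure U, f x = c + ∫ t in (0 : ℝ)..x, g t := by
  have hG : Continuous fun x => ∫ t in (0 : ℝ)..x, g t :=
    intervalIntegral.continuous_primitive (fun _ _ =>
      (hg.integrableOn_isCompact isCompact_uIcc).intervalIntegrable) 0
  have hW : IsWeakDeriv U (fun x => ∫ t in (0 : ℝ)..x, g t) g :=
    isWeakDeriv_of_eq_primitive (c := 0) hU hg fun x _ => by rw [zero_add]
  obtain ⟨c, hc⟩ := exists_ae_eq_const_of_integral_mul_deriv_eq_zero hU hconn hne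
    (h.locallyIntegrableOn.sub hW.locallyIntegrableOn) (by
      intro η hη hc hs
      have hint : ∀ {v : ℝ → ℝ}, LocallyIntegrableOn v U →
          IntegrableOn (fun x => v x * deriv η x) U := by
        intro v hv
        have hs' := tsupport_deriv_subset_of_subset hs
        have h := (hv.integrableOn_compact_subset hs' hc.deriv).mul_continuousOn
          (hη.continuous_deriv (by norm_num)).continuousOn hc.deriv
        refine ((integrableOn_iff_integrable_of_support_subset fun x hx => ?_).1 h).integrableOn
        exact subset_tsupport (deriv η) fun h0 => hx (by simp [h0])
      have e : ∫ x in U, ((f - fun x => ∫ t in (0 : ℝ)..x, g t) x) * deriv η x =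
          (∫ x in U, f x * deriv η x) - ∫ x in U, (∫ t in (0 : ℝ)..x, g t) * deriv η x := by
        rw [← integral_sub (hint h.locallyIntegrableOn) (hint hW.locallyIntegrableOn)]
        exact integral_congr_ae (Filter.Eventually.of_forall fun x => by
          simp only [Pi.sub_apply]; ring)
      rw [e, h.integral_eq η hη hc hs, hW.integral_eq η hη hc hs, sub_self])
  refine ⟨c, fun x hx => ?_⟩
  have hcont : ContinuousOn (fun x => f x - ∫ t in (0 : ℝ)..x, g t) (closure U) :=
    hf.sub hG.continuousOn
  have hEq : EqOn (fun x => f x - ∫ t in (0 : ℝ)..x, g t) (fun _ => c) U := by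
    refine Measure.eqOn_open_of_ae_eq (μ := volume) ?_ hU (hcont.mono subset_closure)
      continuousOn_const
    rw [Filter.EventuallyEq, ae_restrict_iff' hU.measurableSet]
    exact hc
  have := hEq.of_subset_closure hcont continuousOn_const subset_closure subset_rfl hx
  simp only at this
  linarith

/-! ### Increment bounds imply absolute continuity and an energy estimate. -/

section SlopeBound

variable {f Γ : ℝ → ℝ} {a b : ℝ}

/-- `f` satisfies the increment bound `(f x - f y)² ≤ (y - x) (Γ y - Γ x)` on `[a, b]`. -/
def SqIncrementBound (f Γ : ℝ → ℝ) (a b : ℝ) : Prop :=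
  ∀ x ∈ Icc a b, ∀ y ∈ Icc a b, x ≤ y → (f x - f y) ^ 2 ≤ (y - x) * (Γ y - Γ x)

theorem SqIncrementBound.mono {c d : ℝ} (h : SqIncrementBound f Γ a b)
    (hcd : Icc c d ⊆ Icc a b) : SqIncrementBound f Γ c d :=
  fun x hx y hy => h x (hcd hx) y (hcd hy)

theorem SqIncrementBound.neg (h : SqIncrementBound f Γ a b) :
    SqIncrementBound (fun x => -f x) Γ a b := fun x hx y hy hxy => by
  have := h x hx y hy hxy
  nlinarith

/-- By AM-GM, |f x - f y| ≤ r (y - x) + r⁻¹ (Γ y - Γ x). So f is a difference of monotone functions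
and Lebesgue's theorem applies to it; r is kept free so that it can be sent to infinity later. -/
theorem SqIncrementBound.monotoneOn_add (hΓ : MonotoneOn Γ (Icc a b))
    (h : SqIncrementBound f Γ a b) {r : ℝ} (hr : 0 < r) :
    MonotoneOn (fun x => r * x + r⁻¹ * Γ x + f x) (Icc a b) := by
  intro x hx y hy hxy
  have h1 := h x hx y hy hxy
  have h2 : 0 ≤ Γ y - Γ x := sub_nonneg.2 (hΓ hx hy hxy)
  have h3 : 0 ≤ r * (y - x) := mul_nonneg hr.le (sub_nonneg.2 hxy)
  have h4 : 0 ≤ r⁻¹ * (Γ y - Γ x) := mul_nonneg (inv_nonneg.2 hr.le) h2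
  have h5 : (r * (y - x)) * (r⁻¹ * (Γ y - Γ x)) = (y - x) * (Γ y - Γ x) := by
    field_simp
  have h6 : f x - f y ≤ r * (y - x) + r⁻¹ * (Γ y - Γ x) := by
    refine (abs_le_of_sq_le_sq' ?_ (add_nonneg h3 h4)).2
    nlinarith [mul_nonneg h3 h4, sq_nonneg (r * (y - x)), sq_nonneg (r⁻¹ * (Γ y - Γ x))]
  show r * x + r⁻¹ * Γ x + f x ≤ r * y + r⁻¹ * Γ y + f y
  nlinarith

theorem MonotoneOn.ae_differentiableAt_Ioo (hΓ : MonotoneOn Γ (Icc a b)) :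
    ∀ᵐ x, x ∈ Ioo a b → DifferentiableAt ℝ Γ x := by
  filter_upwards [hΓ.ae_differentiableWithinAt_of_mem] with x hx hxab
  exact (hx (Ioo_subset_Icc_self hxab)).differentiableAt (Icc_mem_nhds hxab.1 hxab.2)

theorem SqIncrementBound.ae_differentiableAt (hΓ : MonotoneOn Γ (Icc a b))
    (h : SqIncrementBound f Γ a b) : ∀ᵐ x, x ∈ Ioo a b → DifferentiableAt ℝ f x := by
  filter_upwards [(h.monotoneOn_add hΓ one_pos).ae_differentiableAt_Ioo,
    hΓ.ae_differentiableAt_Ioo] with x h1 h2 hx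
  have := (h1 hx).sub ((differentiableAt_id.const_mul (1 : ℝ)).add ((h2 hx).const_mul 1⁻¹))
  refine this.congr_of_eventuallyEq (Filter.Eventually.of_forall fun y => ?_)
  simp only [Pi.sub_apply, Pi.add_apply, id]
  ring

/-- Divide the increment bound by (y - x)² and let y decrease to x. -/
theorem SqIncrementBound.ae_sq_deriv_le (hΓ : MonotoneOn Γ (Icc a b))
    (h : SqIncrementBound f Γ a b) : ∀ᵐ x, x ∈ Ioo a b → deriv f x ^ 2 ≤ deriv Γ x := by
  filter_upwards [h.ae_differentiableAt hΓ, hΓ.ae_differentiableAt_Ioo] with x h1 h2 hx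
  have t1 := ((h1 hx).hasDerivAt.tendsto_slope.mono_left
    (nhdsWithin_mono x fun y (hy : y ∈ Ioi x) => (ne_of_gt hy : y ≠ x))).pow 2
  have t2 := (h2 hx).hasDerivAt.tendsto_slope.mono_left
    (nhdsWithin_mono x fun y (hy : y ∈ Ioi x) => (ne_of_gt hy : y ≠ x))
  refine le_of_tendsto_of_tendsto t1 t2 ?_
  filter_upwards [Ioo_mem_nhdsGT hx.2] with y hy
  have h3 := h x (Ioo_subset_Icc_self hx) y ⟨hx.1.le.trans hy.1.le, hy.2.le⟩ hy.1.le
  have h4 : 0 < y - x := sub_pos.2 hy.1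
  rw [slope_def_field, slope_def_field, div_pow, div_le_div_iff₀ (by positivity) h4]
  nlinarith

theorem MonotoneOn.integral_deriv_le (hab : a ≤ b) (hΓ : MonotoneOn Γ (Icc a b)) :
    IntervalIntegrable (deriv Γ) volume a b ∧ ∫ x in a..b, deriv Γ x ≤ Γ b - Γ a := by
  rw [← uIcc_of_le hab] at hΓ
  refine ⟨hΓ.intervalIntegrable_deriv, ?_⟩
  have h := hΓ.intervalIntegral_deriv_mem_uIcc
  rw [uIcc_of_le (sub_nonneg.2 (hΓ left_mem_uIcc right_mem_uIcc hab))] at h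
  exact h.2

theorem ae_uIoc_of_ae_Ioo (hab : a ≤ b) {P : ℝ → Prop} (h : ∀ᵐ x, x ∈ Ioo a b → P x) :
    ∀ᵐ x, x ∈ uIoc a b → P x := by
  filter_upwards [h, compl_mem_ae_iff.2 (measure_singleton b)] with x hx hxb hxab
  rw [uIoc_of_le hab] at hxab
  exact hx ⟨hxab.1, lt_of_le_of_ne hxab.2 hxb⟩

theorem SqIncrementBound.ae_deriv_add (hΓ : MonotoneOn Γ (Icc a b))
    (h : SqIncrementBound f Γ a b) (r : ℝ) :
    ∀ᵐ x, x ∈ Ioo a b →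
      deriv (fun x => r * x + r⁻¹ * Γ x + f x) x = r + r⁻¹ * deriv Γ x + deriv f x := by
  filter_upwards [h.ae_differentiableAt hΓ, hΓ.ae_differentiableAt_Ioo] with x h1 h2 hx
  have := (((hasDerivAt_id x).const_mul r).add ((h2 hx).hasDerivAt.const_mul r⁻¹)).add
    (h1 hx).hasDerivAt
  rw [mul_one] at this
  exact this.deriv

theorem SqIncrementBound.intervalIntegrable_deriv (hab : a ≤ b) (hΓ : MonotoneOn Γ (Icc a b))
    (h : SqIncrementBound f Γ a b) : IntervalIntegrable (deriv f) volume a b := by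
  have h1 := ((h.monotoneOn_add hΓ one_pos).integral_deriv_le hab).1
  have h2 := (hΓ.integral_deriv_le hab).1
  refine ((h1.sub (intervalIntegrable_const (c := (1 : ℝ)))).sub h2).congr_ae ?_
  rw [Filter.EventuallyEq, ae_restrict_iff' measurableSet_uIoc]
  filter_upwards [ae_uIoc_of_ae_Ioo hab (h.ae_deriv_add hΓ 1)] with x hx hxab
  simp only [hx hxab]
  ring

/-- Lebesgue's inequality for the monotone function r x + r⁻¹ Γ + f loses nothing on the linear term
and only r⁻¹ (Γ b - Γ a - ∫ Γ') on the Γ term. This vanishes as r → ∞: f has no singular part even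
if Γ has one. Applying this to -f as well yields equality. -/
theorem SqIncrementBound.integral_deriv_le (hab : a ≤ b) (hΓ : MonotoneOn Γ (Icc a b))
    (h : SqIncrementBound f Γ a b) : ∫ x in a..b, deriv f x ≤ f b - f a := by
  have h2 := hΓ.integral_deriv_le hab
  have h3 := h.intervalIntegrable_deriv hab hΓ
  have key : ∀ r : ℝ, 0 < r → ∫ x in a..b, deriv f x ≤
      f b - f a + r⁻¹ * ((Γ b - Γ a) - ∫ x in a..b, deriv Γ x) := by
    intro r hr
    have h1 := ((h.monotoneOn_add hΓ hr).integral_deriv_le hab).2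
    rw [intervalIntegral.integral_congr_ae (ae_uIoc_of_ae_Ioo hab (h.ae_deriv_add hΓ r)),
      intervalIntegral.integral_add (intervalIntegrable_const.add (h2.1.const_mul _)) h3,
      intervalIntegral.integral_add intervalIntegrable_const (h2.1.const_mul _),
      intervalIntegral.integral_const, intervalIntegral.integral_const_mul, smul_eq_mul] at h1
    nlinarith
  have t : Filter.Tendsto (fun r : ℝ => f b - f a + r⁻¹ * ((Γ b - Γ a) - ∫ x in a..b, deriv Γ x))
      Filter.atTop (nhds (f b - f a + 0 * ((Γ b - Γ a) - ∫ x in a..b, deriv Γ x))) :=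
    (tendsto_inv_atTop_zero.mul_const _).const_add _
  rw [zero_mul, add_zero] at t
  exact ge_of_tendsto t ((Filter.eventually_gt_atTop 0).mono key)

theorem SqIncrementBound.integral_deriv_eq_sub (hab : a ≤ b) (hΓ : MonotoneOn Γ (Icc a b))
    (h : SqIncrementBound f Γ a b) : ∫ x in a..b, deriv f x = f b - f a := by
  refine le_antisymm (h.integral_deriv_le hab hΓ) ?_
  have := h.neg.integral_deriv_le hab hΓ
  simp only [deriv.fun_neg, intervalIntegral.integral_neg] at this
  linarith

theorem SqIncrementBound.integral_sq_deriv_le (hab : a ≤ b) (hΓ : MonotoneOn Γ (Icc a b))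
    (h : SqIncrementBound f Γ a b) :
    IntervalIntegrable (fun x => deriv f x ^ 2) volume a b ∧
      ∫ x in a..b, deriv f x ^ 2 ≤ Γ b - Γ a := by
  have h2 := hΓ.integral_deriv_le hab
  have hle := ae_uIoc_of_ae_Ioo hab (h.ae_sq_deriv_le hΓ)
  have hi : IntervalIntegrable (fun x => deriv f x ^ 2) volume a b := by
    refine h2.1.mono_fun ((measurable_deriv f).pow_const 2).aestronglyMeasurable ?_
    rw [Filter.EventuallyLE, ae_restrict_iff' measurableSet_uIoc]
    filter_upwards [hle] with x hx hxab
    rw [Real.norm_eq_abs, Real.norm_eq_abs, abs_of_nonneg (sq_nonneg _)]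
    exact (hx hxab).trans (le_abs_self _)
  refine ⟨hi, le_trans ?_ h2.2⟩
  refine intervalIntegral.integral_mono_ae_restrict hab hi h2.1 ?_
  rw [Filter.EventuallyLE, ← restrict_Ioo_eq_restrict_Icc, ae_restrict_iff' measurableSet_Ioo]
  exact h.ae_sq_deriv_le hΓ

/-- The energy bound is strict if on a subinterval, at whose endpoints `f` differs, the increment
bound holds with an additional factor `4`. -/
theorem SqIncrementBound.integral_sq_deriv_lt (hΓ : MonotoneOn Γ (Icc a b))
    (h : SqIncrementBound f Γ a b) {c d : ℝ} (hac : a ≤ c) (hcd : c ≤ d) (hdb : d ≤ b)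
    (h' : SqIncrementBound (fun x => 2 * f x) Γ c d) (hne : f c ≠ f d) :
    ∫ x in a..b, deriv f x ^ 2 < Γ b - Γ a := by
  have s1 : Icc a c ⊆ Icc a b := Icc_subset_Icc le_rfl (hcd.trans hdb)
  have s2 : Icc c d ⊆ Icc a b := Icc_subset_Icc hac hdb
  have s3 : Icc d b ⊆ Icc a b := Icc_subset_Icc (hac.trans hcd) le_rfl
  have i1 := (h.mono s1).integral_sq_deriv_le hac (hΓ.mono s1)
  have i2 := (h.mono s2).integral_sq_deriv_le hcd (hΓ.mono s2)
  have i3 := (h.mono s3).integral_sq_deriv_le hdb (hΓ.mono s3)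
  have i4 := (h'.integral_sq_deriv_le hcd (hΓ.mono s2)).2
  -- On [c, d] the integral of f'² is at most a quarter of the increment of Γ. It is positive
  -- because f c ≠ f d, so the estimate there is strict.
  have e : (fun x => deriv (fun x => 2 * f x) x ^ 2) = fun x => 4 * deriv f x ^ 2 := by
    funext x
    rw [deriv_const_mul_field]
    ring
  rw [e, intervalIntegral.integral_const_mul] at i4
  rw [← intervalIntegral.integral_add_adjacent_intervals (i1.1.trans i2.1) i3.1,
    ← intervalIntegral.integral_add_adjacent_intervals i1.1 i2.1]
  have hpos : 0 < ∫ x in c..d, deriv f x ^ 2 := by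
    refine lt_of_le_of_ne (intervalIntegral.integral_nonneg hcd fun x _ => sq_nonneg _) ?_
    intro h0
    have hz := (intervalIntegral.integral_eq_zero_iff_of_le_of_nonneg_ae hcd
      (Filter.Eventually.of_forall fun x => sq_nonneg (deriv f x)) i2.1).1 h0.symm
    have h5 := (h.mono s2).integral_deriv_eq_sub hcd (hΓ.mono s2)
    rw [intervalIntegral.integral_of_le hcd, integral_eq_zero_of_ae] at h5
    · exact hne (by linarith)
    · filter_upwards [hz] with x hx
      exact pow_eq_zero_iff (two_ne_zero) |>.1 hx
  linarith [i1.2, i3.2]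

end SlopeBound

/-! ### Primitives and the variation of their truncations. -/

/-- `f` is a primitive of the square integrable function `g`. -/
structure IsPrimitive (f g : ℝ → ℝ) : Prop where
  memLp : MemLp g 2 volume
  sub_eq : ∀ x y, f y - f x = ∫ t in x..y, g t

/-- The absolute slope `|g|` of `f`, cut off outside `{t₁ < f < t₂}`. -/
noncomputable def truncSlope (f g : ℝ → ℝ) (t₁ t₂ : ℝ) : ℝ → ℝ :=
  (f ⁻¹' Ioo t₁ t₂).indicator fun x => |g x|

/-- Truncation to the interval `[t₁, t₂]`. -/
def clamp (t₁ t₂ s : ℝ) : ℝ := max t₁ (min t₂ s)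

theorem clamp_eq_left {t₁ t₂ s : ℝ} (h : s ≤ t₁) : clamp t₁ t₂ s = t₁ :=
  max_eq_left ((min_le_right _ _).trans h)

theorem clamp_eq_right {t₁ t₂ s : ℝ} (h12 : t₁ ≤ t₂) (h : t₂ ≤ s) : clamp t₁ t₂ s = t₂ := by
  rw [clamp, min_eq_left h, max_eq_right h12]

theorem clamp_neg {t₁ t₂ s : ℝ} (h : t₁ ≤ t₂) : clamp (-t₂) (-t₁) (-s) = -clamp t₁ t₂ s := by
  rw [clamp, clamp, min_neg_neg, max_neg_neg, neg_inj]
  rcases le_total s t₁ with h1 | h1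
  · rw [max_eq_left h1, min_eq_right h, max_eq_left ((min_le_right _ _).trans h1)]
  · rw [max_eq_right h1, max_eq_right (le_min h h1)]

theorem truncSlope_nonneg (f g : ℝ → ℝ) (t₁ t₂ x : ℝ) : 0 ≤ truncSlope f g t₁ t₂ x :=
  indicator_nonneg (fun _ _ => abs_nonneg _) _

theorem truncSlope_neg (f g : ℝ → ℝ) (t₁ t₂ : ℝ) :
    truncSlope (fun x => -f x) (fun x => -g x) (-t₂) (-t₁) = truncSlope f g t₁ t₂ := by
  have : (fun x => -f x) ⁻¹' Ioo (-t₂) (-t₁) = f ⁻¹' Ioo t₁ t₂ := by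
    ext x
    simp only [mem_preimage, mem_Ioo, neg_lt_neg_iff]
    exact and_comm
  simp only [truncSlope, this, abs_neg]

namespace IsPrimitive

variable {f g : ℝ → ℝ} {t₁ t₂ : ℝ}

theorem locallyIntegrable (h : IsPrimitive f g) : LocallyIntegrable g :=
  h.memLp.locallyIntegrable (by norm_num)

theorem intervalIntegrable (h : IsPrimitive f g) (x y : ℝ) : IntervalIntegrable g volume x y :=
  (h.locallyIntegrable.integrableOn_isCompact isCompact_uIcc).intervalIntegrable

theorem eq_primitive (h : IsPrimitive f g) (x : ℝ) : f x = f 0 + ∫ t in (0 : ℝ)..x, g t := by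
  rw [← h.sub_eq]
  ring

theorem continuous (h : IsPrimitive f g) : Continuous f := by
  rw [show f = _ from funext h.eq_primitive]
  exact continuous_const.add (intervalIntegral.continuous_primitive h.intervalIntegrable 0)

theorem neg (h : IsPrimitive f g) : IsPrimitive (fun x => -f x) (fun x => -g x) :=
  ⟨h.memLp.neg, fun x y => by rw [intervalIntegral.integral_neg, ← h.sub_eq]; ring⟩

theorem measurableSet_preimage (h : IsPrimitive f g) (t₁ t₂ : ℝ) :
    MeasurableSet (f ⁻¹' Ioo t₁ t₂) :=
  h.continuous.measurable measurableSet_Ioo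

theorem intervalIntegrable_truncSlope (h : IsPrimitive f g) (t₁ t₂ x y : ℝ) :
    IntervalIntegrable (truncSlope f g t₁ t₂) volume x y := by
  have := (h.intervalIntegrable x y).abs
  exact ⟨this.1.indicator (h.measurableSet_preimage _ _),
    this.2.indicator (h.measurableSet_preimage _ _)⟩

/-- Let a < b be the truncated values, c the last point with f ≤ a, and d the first point after c
with f ≥ b. Between c and d, f stays in (a, b) ⊆ (t₁, t₂), so the cut-off does not act and no chain
rule is needed. -/
theorem clamp_sub_clamp_le (h : IsPrimitive f g) {x y : ℝ} (hxy : x ≤ y) :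
    clamp t₁ t₂ (f y) - clamp t₁ t₂ (f x) ≤ ∫ t in x..y, truncSlope f g t₁ t₂ t := by
  rcases le_or_gt (clamp t₁ t₂ (f y)) (clamp t₁ t₂ (f x)) with hle | hlt
  · exact (sub_nonpos.2 hle).trans
      (intervalIntegral.integral_nonneg hxy fun t _ => truncSlope_nonneg _ _ _ _ t)
  set a := clamp t₁ t₂ (f x) with ha
  set b := clamp t₁ t₂ (f y) with hb
  have ha1 : t₁ ≤ a := le_max_left _ _
  have hb1 : b ≤ f y := by
    rcases max_cases t₁ (min t₂ (f y)) with h1 | h1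
    · exact absurd (ha1.trans_lt hlt) (by rw [hb, clamp, h1.1]; exact lt_irrefl _)
    · rw [hb, clamp, h1.1]; exact min_le_right _ _
  have hb2 : b ≤ t₂ := by
    rcases max_cases t₁ (min t₂ (f y)) with h1 | h1
    · exact absurd (ha1.trans_lt hlt) (by rw [hb, clamp, h1.1]; exact lt_irrefl _)
    · rw [hb, clamp, h1.1]; exact min_le_left _ _
  have ha2 : f x ≤ a := by
    by_contra! hc
    have : min t₂ (f x) ≤ a := le_max_right _ _
    rcases min_le_iff.1 this with h1 | h1
    · linarith
    · linarith
  obtain ⟨c, hc, hc'⟩ := (isCompact_Icc.inter_right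
    (isClosed_Iic.preimage h.continuous) : IsCompact (Icc x y ∩ f ⁻¹' Iic a)).exists_isGreatest
    ⟨x, left_mem_Icc.2 hxy, ha2⟩
  obtain ⟨d, hd, hd'⟩ := (isCompact_Icc.inter_right
    (isClosed_Ici.preimage h.continuous) : IsCompact (Icc c y ∩ f ⁻¹' Ici b)).exists_isLeast
    ⟨y, right_mem_Icc.2 hc.1.2, hb1⟩
  have hcd : c ≤ d := hd.1.1
  have hfc : f c ≤ a := hc.2
  have hfd : b ≤ f d := hd.2
  calc b - a ≤ f d - f c := by linarith
    _ = ∫ t in c..d, g t := h.sub_eq c d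
    _ ≤ ∫ t in c..d, |g t| := intervalIntegral.integral_mono_on hcd (h.intervalIntegrable c d)
        (h.intervalIntegrable c d).abs fun t _ => le_abs_self _
    _ = ∫ t in c..d, truncSlope f g t₁ t₂ t := by
        refine intervalIntegral.integral_congr_uIoo fun t ht => ?_
        rw [uIoo_of_le hcd] at ht
        have hta : a < f t := by
          by_contra! hta
          exact ht.1.not_ge (hc' ⟨⟨hc.1.1.trans ht.1.le, ht.2.le.trans hd.1.2⟩, hta⟩)
        have htb : f t < b := by
          by_contra! htb
          exact ht.2.not_ge (hd' ⟨⟨ht.1.le, ht.2.le.trans hd.1.2⟩, htb⟩)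
        have ht' : t ∈ f ⁻¹' Ioo t₁ t₂ := ⟨ha1.trans_lt hta, htb.trans_le hb2⟩
        exact (indicator_of_mem ht' fun x => |g x|).symm
    _ ≤ ∫ t in x..y, truncSlope f g t₁ t₂ t :=
        intervalIntegral.integral_mono_interval hc.1.1 hcd hd.1.2
          (Filter.Eventually.of_forall fun t => truncSlope_nonneg _ _ _ _ t)
          (h.intervalIntegrable_truncSlope _ _ _ _)

/-- The variation of the truncation of `f` is controlled by the truncated slope. -/
theorem abs_clamp_sub_clamp_le (h : IsPrimitive f g) (h12 : t₁ ≤ t₂) {x y : ℝ} (hxy : x ≤ y) :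
    |clamp t₁ t₂ (f y) - clamp t₁ t₂ (f x)| ≤ ∫ t in x..y, truncSlope f g t₁ t₂ t := by
  refine abs_le'.2 ⟨h.clamp_sub_clamp_le hxy, ?_⟩
  have := h.neg.clamp_sub_clamp_le (t₁ := -t₂) (t₂ := -t₁) hxy
  rw [truncSlope_neg, clamp_neg h12, clamp_neg h12] at this
  linarith

theorem integrableOn_abs (h : IsPrimitive f g) {A : Set ℝ} (hA : volume A ≠ ⊤) :
    IntegrableOn (fun x => |g x|) A := by
  have : IsFiniteMeasure (volume.restrict A) := ⟨by simpa using hA.lt_top⟩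
  exact ((h.memLp.restrict A).integrable (by norm_num)).abs

theorem integrable_sq (h : IsPrimitive f g) : Integrable fun x => g x ^ 2 :=
  h.memLp.integrable_sq

/-- Integrating 2c|g| ≤ c² + g² leaves a quadratic inequality in c. In this form it can be added
over the two branches before the discriminant is taken. -/
theorem two_mul_setIntegral_abs_le (h : IsPrimitive f g) {A : Set ℝ} (hA : volume A ≠ ⊤) (c : ℝ) :
    2 * c * ∫ x in A, |g x| ≤ c ^ 2 * volume.real A + ∫ x in A, g x ^ 2 := by
  have hci : IntegrableOn (fun _ : ℝ => c ^ 2) A := integrableOn_const hA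
  have e : c ^ 2 * volume.real A = ∫ _ in A, c ^ 2 := by
    rw [setIntegral_const, smul_eq_mul, mul_comm]
  rw [e, ← integral_const_mul, ← integral_add hci h.integrable_sq.integrableOn]
  refine integral_mono ((h.integrableOn_abs hA).const_mul _)
    (hci.add h.integrable_sq.integrableOn) fun x => ?_
  have := sq_abs (g x)
  simp only
  nlinarith [sq_nonneg (c - |g x|)]

end IsPrimitive

/-! ### Length and energy of strips, and paths crossing them. -/

namespace PendantFun

/-- `w` is the pair of slopes of `u`, both branches of `u` being extended to `ℝ`. -/
structure HasSlope (u w : PendantFun) : Prop where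
  line : IsPrimitive u.line w.line
  pendant : IsPrimitive u.pendant w.pendant
  junction : u.line 0 = u.pendant 0

/-- The push-forward of length under `u`. -/
noncomputable def levelMeasure (ℓ : ℝ) (u : PendantFun) : Measure ℝ :=
  volume.map u.line + (volume.restrict (Icc 0 ℓ)).map u.pendant

/-- The push-forward under `u` of the measure with density `w²`. -/
noncomputable def energyMeasure (ℓ : ℝ) (u w : PendantFun) : Measure ℝ :=
  (volume.withDensity fun x => ENNReal.ofReal (w.line x ^ 2)).map u.line +
    ((volume.restrict (Icc 0 ℓ)).withDensity
      fun x => ENNReal.ofReal (w.pendant x ^ 2)).map u.pendant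

/-- The integral of `|w|` over `{t₁ < u < t₂}`. -/
noncomputable def slopeIntegral (ℓ : ℝ) (u w : PendantFun) (t₁ t₂ : ℝ) : ℝ :=
  (∫ x, truncSlope u.line w.line t₁ t₂ x) +
    ∫ x in (0 : ℝ)..ℓ, truncSlope u.pendant w.pendant t₁ t₂ x

variable {ℓ t₁ t₂ : ℝ} {u w : PendantFun}

theorem levelMeasure_apply (hl : Measurable u.line)
    (hp : AEMeasurable u.pendant (volume.restrict (Icc 0 ℓ))) {S : Set ℝ} (hS : MeasurableSet S) :
    u.levelMeasure ℓ S = u.meas ℓ S := by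
  rw [levelMeasure, meas, Measure.add_apply, Measure.map_apply hl hS,
    Measure.map_apply_of_aemeasurable hp hS, Measure.restrict_apply' measurableSet_Icc,
    inter_comm]
  rfl

namespace HasSlope

theorem levelMeasure_apply (h : HasSlope u w) {S : Set ℝ} (hS : MeasurableSet S) :
    u.levelMeasure ℓ S = volume (u.line ⁻¹' S) + volume (Icc 0 ℓ ∩ u.pendant ⁻¹' S) :=
  PendantFun.levelMeasure_apply h.line.continuous.measurable
    h.pendant.continuous.measurable.aemeasurable hS

theorem energyMeasure_apply (h : HasSlope u w) {S : Set ℝ} (hS : MeasurableSet S) :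
    u.energyMeasure ℓ w S = ENNReal.ofReal (∫ x in u.line ⁻¹' S, w.line x ^ 2) +
      ENNReal.ofReal (∫ x in Icc 0 ℓ ∩ u.pendant ⁻¹' S, w.pendant x ^ 2) := by
  have m1 : MeasurableSet (u.line ⁻¹' S) := h.line.continuous.measurable hS
  have m2 : MeasurableSet (u.pendant ⁻¹' S) := h.pendant.continuous.measurable hS
  rw [energyMeasure, Measure.add_apply, Measure.map_apply h.line.continuous.measurable hS,
    Measure.map_apply h.pendant.continuous.measurable hS, withDensity_apply _ m1,
    withDensity_apply _ m2, Measure.restrict_restrict m2, inter_comm,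
    ofReal_integral_eq_lintegral_ofReal h.line.integrable_sq.integrableOn
      (Filter.Eventually.of_forall fun x => sq_nonneg _),
    ofReal_integral_eq_lintegral_ofReal h.pendant.integrable_sq.integrableOn
      (Filter.Eventually.of_forall fun x => sq_nonneg _)]

theorem energyMeasure_real (h : HasSlope u w) {S : Set ℝ} (hS : MeasurableSet S) :
    (u.energyMeasure ℓ w).real S = (∫ x in u.line ⁻¹' S, w.line x ^ 2) +
      ∫ x in Icc 0 ℓ ∩ u.pendant ⁻¹' S, w.pendant x ^ 2 := by
  have n1 : 0 ≤ ∫ x in u.line ⁻¹' S, w.line x ^ 2 := integral_nonneg fun _ => sq_nonneg _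
  have n2 : 0 ≤ ∫ x in Icc 0 ℓ ∩ u.pendant ⁻¹' S, w.pendant x ^ 2 :=
    integral_nonneg fun _ => sq_nonneg _
  rw [Measure.real, h.energyMeasure_apply hS, ← ENNReal.ofReal_add n1 n2,
    ENNReal.toReal_ofReal (add_nonneg n1 n2)]

theorem isFiniteMeasure_energyMeasure (h : HasSlope u w) :
    IsFiniteMeasure (u.energyMeasure ℓ w) := by
  refine ⟨?_⟩
  rw [h.energyMeasure_apply MeasurableSet.univ]
  exact ENNReal.add_lt_top.2 ⟨ENNReal.ofReal_lt_top, ENNReal.ofReal_lt_top⟩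

theorem volume_line_ne_top (h : HasSlope u w) {S : Set ℝ} (hS : MeasurableSet S)
    (hfin : u.levelMeasure ℓ S ≠ ⊤) : volume (u.line ⁻¹' S) ≠ ⊤ := by
  rw [h.levelMeasure_apply hS] at hfin
  exact (ENNReal.add_ne_top.1 hfin).1

theorem integrable_truncSlope_line (h : HasSlope u w)
    (hfin : u.levelMeasure ℓ (Ioo t₁ t₂) ≠ ⊤) :
    Integrable (truncSlope u.line w.line t₁ t₂) :=
  (integrable_indicator_iff (h.line.measurableSet_preimage _ _)).2
    (h.line.integrableOn_abs (h.volume_line_ne_top measurableSet_Ioo hfin))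

/-- The Cauchy-Schwarz inequality on `{t₁ < u < t₂}`. -/
theorem sq_slopeIntegral_le (h : HasSlope u w) (hℓ : 0 ≤ ℓ)
    (hfin : u.levelMeasure ℓ (Ioo t₁ t₂) ≠ ⊤) :
    u.slopeIntegral ℓ w t₁ t₂ ^ 2 ≤
      (u.levelMeasure ℓ).real (Ioo t₁ t₂) * (u.energyMeasure ℓ w).real (Ioo t₁ t₂) := by
  set A := u.line ⁻¹' Ioo t₁ t₂ with hA
  set B := Icc 0 ℓ ∩ u.pendant ⁻¹' Ioo t₁ t₂ with hB
  have hfA : volume A ≠ ⊤ := h.volume_line_ne_top measurableSet_Ioo hfin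
  have hfB : volume B ≠ ⊤ :=
    ((measure_mono inter_subset_left).trans_lt (measure_Icc_lt_top (μ := volume))).ne
  have e1 : u.slopeIntegral ℓ w t₁ t₂ = (∫ x in A, |w.line x|) + ∫ x in B, |w.pendant x| := by
    rw [slopeIntegral, intervalIntegral.integral_of_le hℓ, ← integral_Icc_eq_integral_Ioc]
    simp only [truncSlope]
    rw [integral_indicator (h.line.measurableSet_preimage _ _),
      setIntegral_indicator (h.pendant.measurableSet_preimage _ _)]
  have e2 : (u.levelMeasure ℓ).real (Ioo t₁ t₂) = volume.real A + volume.real B := by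
    rw [Measure.real, h.levelMeasure_apply measurableSet_Ioo, ENNReal.toReal_add hfA hfB]
    rfl
  rw [e1, e2, h.energyMeasure_real measurableSet_Ioo]
  -- The discriminant of this everywhere nonnegative quadratic gives Cauchy–Schwarz on the whole
  -- graph at once.
  have key : ∀ c : ℝ, 0 ≤ (volume.real A + volume.real B) * (c * c) +
      (-(2 * ((∫ x in A, |w.line x|) + ∫ x in B, |w.pendant x|))) * c +
      ((∫ x in A, w.line x ^ 2) + ∫ x in B, w.pendant x ^ 2) := by
    intro c
    have := h.line.two_mul_setIntegral_abs_le hfA c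
    have := h.pendant.two_mul_setIntegral_abs_le hfB c
    nlinarith
  have := discrim_le_zero key
  rw [discrim] at this
  nlinarith

theorem intervalIntegral_line_le (h : HasSlope u w) (hfin : u.levelMeasure ℓ (Ioo t₁ t₂) ≠ ⊤)
    {x y : ℝ} (hxy : x ≤ y) : ∫ t in x..y, truncSlope u.line w.line t₁ t₂ t ≤
      ∫ t, truncSlope u.line w.line t₁ t₂ t := by
  rw [intervalIntegral.integral_of_le hxy]
  exact setIntegral_le_integral (h.integrable_truncSlope_line hfin)
    (Filter.Eventually.of_forall (truncSlope_nonneg _ _ _ _))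

theorem intervalIntegral_pendant_le (h : HasSlope u w) {x y : ℝ} (hx : 0 ≤ x) (hxy : x ≤ y)
    (hy : y ≤ ℓ) : ∫ t in x..y, truncSlope u.pendant w.pendant t₁ t₂ t ≤
      ∫ t in (0 : ℝ)..ℓ, truncSlope u.pendant w.pendant t₁ t₂ t :=
  intervalIntegral.integral_mono_interval hx hxy hy
    (Filter.Eventually.of_forall (truncSlope_nonneg _ _ _ _))
    (h.pendant.intervalIntegrable_truncSlope _ _ _ _)

theorem integral_line_nonneg : 0 ≤ ∫ t, truncSlope u.line w.line t₁ t₂ t :=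
  integral_nonneg (truncSlope_nonneg _ _ _ _)

theorem integral_pendant_nonneg (hℓ : 0 ≤ ℓ) :
    0 ≤ ∫ t in (0 : ℝ)..ℓ, truncSlope u.pendant w.pendant t₁ t₂ t :=
  intervalIntegral.integral_nonneg hℓ fun t _ => truncSlope_nonneg _ _ _ _ t

theorem abs_clamp_line_sub_le (h : HasSlope u w) (h12 : t₁ ≤ t₂)
    (hfin : u.levelMeasure ℓ (Ioo t₁ t₂) ≠ ⊤) (x y : ℝ) :
    |clamp t₁ t₂ (u.line y) - clamp t₁ t₂ (u.line x)| ≤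
      ∫ t, truncSlope u.line w.line t₁ t₂ t := by
  rcases le_total x y with hxy | hxy
  · exact (h.line.abs_clamp_sub_clamp_le h12 hxy).trans (h.intervalIntegral_line_le hfin hxy)
  · rw [abs_sub_comm]
    exact (h.line.abs_clamp_sub_clamp_le h12 hxy).trans (h.intervalIntegral_line_le hfin hxy)

/-- A path joining two points of the line. -/
theorem sub_le_slopeIntegral_of_line (h : HasSlope u w) (hℓ : 0 ≤ ℓ) (h12 : t₁ ≤ t₂)
    (hfin : u.levelMeasure ℓ (Ioo t₁ t₂) ≠ ⊤) {x y : ℝ} (hx : u.line x ≤ t₁) (hy : t₂ ≤ u.line y) :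
    t₂ - t₁ ≤ u.slopeIntegral ℓ w t₁ t₂ := by
  have h1 := h.abs_clamp_line_sub_le h12 hfin x y
  rw [clamp_eq_left hx, clamp_eq_right h12 hy] at h1
  have h2 := integral_pendant_nonneg (u := u) (w := w) (t₁ := t₁) (t₂ := t₂) hℓ
  rw [slopeIntegral]
  linarith [le_abs_self (t₂ - t₁)]

/-- A path joining a point of the line to a point of the pendant. -/
theorem sub_le_slopeIntegral_of_pendant (h : HasSlope u w) (h12 : t₁ ≤ t₂)
    (hfin : u.levelMeasure ℓ (Ioo t₁ t₂) ≠ ⊤) {x y : ℝ} (hy : y ∈ Icc 0 ℓ)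
    (hx : u.line x ≤ t₁) (hy' : t₂ ≤ u.pendant y) :
    t₂ - t₁ ≤ u.slopeIntegral ℓ w t₁ t₂ := by
  have h1 := h.abs_clamp_line_sub_le h12 hfin x 0
  have h2 := (h.pendant.abs_clamp_sub_clamp_le h12 hy.1).trans
    (h.intervalIntegral_pendant_le le_rfl hy.1 hy.2)
  rw [clamp_eq_left hx, h.junction] at h1
  rw [clamp_eq_right h12 hy'] at h2
  rw [slopeIntegral]
  linarith [(abs_le.1 h1).2, (abs_le.1 h2).2, le_abs_self (clamp t₁ t₂ (u.pendant 0) - t₁),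
    le_abs_self (t₂ - clamp t₁ t₂ (u.pendant 0))]

/-- Two disjoint paths in the line. -/
theorem two_mul_sub_le_slopeIntegral_of_line (h : HasSlope u w) (hℓ : 0 ≤ ℓ) (h12 : t₁ ≤ t₂)
    (hfin : u.levelMeasure ℓ (Ioo t₁ t₂) ≠ ⊤) {x y z : ℝ} (hxy : x ≤ y) (hyz : y ≤ z)
    (hx : u.line x ≤ t₁) (hy : t₂ ≤ u.line y) (hz : u.line z ≤ t₁) :
    2 * (t₂ - t₁) ≤ u.slopeIntegral ℓ w t₁ t₂ := by
  have h1 := h.line.abs_clamp_sub_clamp_le h12 hxy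
  have h2 := h.line.abs_clamp_sub_clamp_le h12 hyz
  rw [clamp_eq_left hx, clamp_eq_right h12 hy] at h1
  rw [clamp_eq_left hz, clamp_eq_right h12 hy, abs_sub_comm] at h2
  have h3 := h.intervalIntegral_line_le hfin (hxy.trans hyz)
  rw [← intervalIntegral.integral_add_adjacent_intervals
    (h.line.intervalIntegrable_truncSlope _ _ _ y)
    (h.line.intervalIntegrable_truncSlope _ _ _ _)] at h3
  have h4 := integral_pendant_nonneg (u := u) (w := w) (t₁ := t₁) (t₂ := t₂) hℓ
  rw [slopeIntegral]
  linarith [le_abs_self (t₂ - t₁)]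

/-- Two disjoint paths in the pendant. -/
theorem two_mul_sub_le_slopeIntegral_of_pendant (h : HasSlope u w) (h12 : t₁ ≤ t₂)
    {x y : ℝ} (hx0 : 0 ≤ x) (hxy : x ≤ y) (hyℓ : y ≤ ℓ) (h0 : u.pendant 0 ≤ t₁)
    (hx : t₂ ≤ u.pendant x) (hy : u.pendant y ≤ t₁) :
    2 * (t₂ - t₁) ≤ u.slopeIntegral ℓ w t₁ t₂ := by
  have h1 := h.pendant.abs_clamp_sub_clamp_le h12 hx0
  have h2 := h.pendant.abs_clamp_sub_clamp_le h12 hxy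
  rw [clamp_eq_left h0, clamp_eq_right h12 hx] at h1
  rw [clamp_eq_left hy, clamp_eq_right h12 hx, abs_sub_comm] at h2
  have h3 := h.intervalIntegral_pendant_le (t₁ := t₁) (t₂ := t₂) le_rfl (hx0.trans hxy) hyℓ
  rw [← intervalIntegral.integral_add_adjacent_intervals
    (h.pendant.intervalIntegrable_truncSlope _ _ _ x)
    (h.pendant.intervalIntegrable_truncSlope _ _ _ _)] at h3
  have h4 := integral_line_nonneg (u := u) (w := w) (t₁ := t₁) (t₂ := t₂)
  rw [slopeIntegral]
  linarith [le_abs_self (t₂ - t₁)]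

end HasSlope

end PendantFun

/-! ### Strip bounds and the distribution function. -/

namespace PendantFun

/-- A positive function with slope `w` whose superlevel sets have finite length and whose level
sets are null. -/
structure Rearrangeable (ℓ : ℝ) (u w : PendantFun) : Prop where
  length_pos : 0 < ℓ
  slope : HasSlope u w
  line_pos : ∀ x, 0 < u.line x
  pendant_pos : ∀ x ∈ Icc 0 ℓ, 0 < u.pendant x
  level_lt_top : ∀ t, 0 < t → u.levelMeasure ℓ (Ioi t) ≠ ⊤
  level_null : ∀ t, 0 < t → u.levelMeasure ℓ {t} = 0

/-- The length of `{u > t}`. -/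
noncomputable def superlevel (ℓ : ℝ) (u : PendantFun) (t : ℝ) : ℝ :=
  (u.levelMeasure ℓ).real (Ioi t)

/-- The supremum of `u`. -/
noncomputable def supValue (ℓ : ℝ) (u : PendantFun) : ℝ :=
  sSup (range u.line ∪ u.pendant '' Icc 0 ℓ)

/-- The product of the length and the energy of `{t₁ < u < t₂}` bounds `(k (t₂ - t₁))²`. -/
def StripBound (ℓ : ℝ) (u w : PendantFun) (k t₁ t₂ : ℝ) : Prop :=
  (k * (t₂ - t₁)) ^ 2 ≤
    (u.levelMeasure ℓ).real (Ioo t₁ t₂) * (u.energyMeasure ℓ w).real (Ioo t₁ t₂)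

namespace Rearrangeable

variable {ℓ t₁ t₂ : ℝ} {u w : PendantFun}

theorem subset_lt_top (h : Rearrangeable ℓ u w) {t : ℝ} (ht : 0 < t) {S : Set ℝ}
    (hS : S ⊆ Ioi t) : u.levelMeasure ℓ S ≠ ⊤ :=
  ((measure_mono hS).trans_lt (h.level_lt_top t ht).lt_top).ne

/-- Superlevel sets have finite length, so they cannot contain a set of infinite length. Applied to
half-lines, this replaces decay at infinity. -/
theorem exists_line_le_of_volume_eq_top (h : Rearrangeable ℓ u w) {t : ℝ} (ht : 0 < t) {S : Set ℝ}
    (hS : volume S = ⊤) : ∃ x ∈ S, u.line x ≤ t := by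
  by_contra! hc
  have h1 : volume S ≤ volume (u.line ⁻¹' Ioi t) := measure_mono fun x hx => hc x hx
  rw [hS, top_le_iff] at h1
  exact h.slope.volume_line_ne_top measurableSet_Ioi (h.level_lt_top t ht) h1

/-- The path estimate is required only for t < t₂, because t₂ may be a supremum that is not known to
be attained; the bound at t₂ follows by continuity. -/
theorem stripBound_of_forall_le (h : Rearrangeable ℓ u w) (h1 : 0 < t₁) (h12 : t₁ ≤ t₂) {k : ℝ}
    (hk : 0 ≤ k) (hα : ∀ t, t₁ < t → t < t₂ → k * (t - t₁) ≤ u.slopeIntegral ℓ w t₁ t) :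
    StripBound ℓ u w k t₁ t₂ := by
  rcases h12.eq_or_lt with rfl | hlt
  · rw [StripBound, sub_self, mul_zero, zero_pow two_ne_zero]
    exact mul_nonneg measureReal_nonneg measureReal_nonneg
  have := h.slope.isFiniteMeasure_energyMeasure (ℓ := ℓ)
  have key : ∀ t, t₁ < t → t < t₂ → (k * (t - t₁)) ^ 2 ≤
      (u.levelMeasure ℓ).real (Ioo t₁ t₂) * (u.energyMeasure ℓ w).real (Ioo t₁ t₂) := by
    intro t ht ht'
    have hsub : Ioo t₁ t ⊆ Ioo t₁ t₂ := Ioo_subset_Ioo le_rfl ht'.le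
    calc (k * (t - t₁)) ^ 2 ≤ u.slopeIntegral ℓ w t₁ t ^ 2 :=
          pow_le_pow_left₀ (mul_nonneg hk (sub_nonneg.2 ht.le)) (hα t ht ht') 2
      _ ≤ _ := h.slope.sq_slopeIntegral_le h.length_pos.le (h.subset_lt_top h1 Ioo_subset_Ioi_self)
      _ ≤ _ := mul_le_mul
          (measureReal_mono hsub (h.subset_lt_top h1 Ioo_subset_Ioi_self))
          (measureReal_mono hsub) measureReal_nonneg measureReal_nonneg
  have hc : Filter.Tendsto (fun t => (k * (t - t₁)) ^ 2) (nhdsWithin t₂ (Iio t₂))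
      (nhds ((k * (t₂ - t₁)) ^ 2)) :=
    (Continuous.tendsto (by fun_prop) t₂).mono_left nhdsWithin_le_nhds
  refine le_of_tendsto hc ?_
  filter_upwards [Ioo_mem_nhdsLT hlt] with t ht using key t ht.1 ht.2

/-- Values below the supremum of `u` on the line are crossed on both sides of a point. -/
theorem stripBound_two_of_line (h : Rearrangeable ℓ u w) (h1 : 0 < t₁) (h12 : t₁ ≤ t₂)
    (hline : ∀ t < t₂, ∃ x, t < u.line x) : StripBound ℓ u w 2 t₁ t₂ := by
  refine h.stripBound_of_forall_le h1 h12 zero_le_two fun t ht ht' => ?_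
  obtain ⟨y, hy⟩ := hline t ht'
  obtain ⟨x, hx, hx'⟩ := h.exists_line_le_of_volume_eq_top h1 (Real.volume_Iic (a := y))
  obtain ⟨z, hz, hz'⟩ := h.exists_line_le_of_volume_eq_top h1 (Real.volume_Ici (a := y))
  exact h.slope.two_mul_sub_le_slopeIntegral_of_line h.length_pos.le ht.le
    (h.subset_lt_top h1 Ioo_subset_Ioi_self) hx hz hx' hy.le hz'

theorem stripBound_two_of_pendant (h : Rearrangeable ℓ u w) (h1 : 0 < t₁) (h12 : t₁ ≤ t₂)
    {x y : ℝ} (hx0 : 0 ≤ x) (hxy : x ≤ y) (hyℓ : y ≤ ℓ) (h0 : u.pendant 0 ≤ t₁)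
    (hx : t₂ ≤ u.pendant x) (hy : u.pendant y ≤ t₁) : StripBound ℓ u w 2 t₁ t₂ :=
  h.stripBound_of_forall_le h1 h12 zero_le_two fun _ ht ht' =>
    h.slope.two_mul_sub_le_slopeIntegral_of_pendant ht.le hx0 hxy hyℓ h0 (ht'.le.trans hx) hy

/-- The strip from 1 to a value u(x) > 1 on the line is crossed twice, so (u(x) - 1)² is bounded by
the length of {u > 1} times the total energy. The pendant is compact. -/
theorem bddAbove (h : Rearrangeable ℓ u w) :
    BddAbove (range u.line ∪ u.pendant '' Icc 0 ℓ) := by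
  refine BddAbove.union ?_
    (isCompact_Icc.image h.slope.pendant.continuous).bddAbove
  have := h.slope.isFiniteMeasure_energyMeasure (ℓ := ℓ)
  refine ⟨1 + √(u.superlevel ℓ 1 * (u.energyMeasure ℓ w).real univ), ?_⟩
  rintro _ ⟨x, rfl⟩
  rcases le_or_gt (u.line x) 1 with hx | hx
  · exact hx.trans (le_add_of_nonneg_right (Real.sqrt_nonneg _))
  have hb : StripBound ℓ u w 2 1 (u.line x) :=
    h.stripBound_two_of_line one_pos hx.le fun t ht => ⟨x, ht⟩
  have h2 : (u.levelMeasure ℓ).real (Ioo 1 (u.line x)) * (u.energyMeasure ℓ w).real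
      (Ioo 1 (u.line x)) ≤ u.superlevel ℓ 1 * (u.energyMeasure ℓ w).real univ :=
    mul_le_mul (measureReal_mono Ioo_subset_Ioi_self (h.level_lt_top 1 one_pos))
      (measureReal_mono (subset_univ _)) measureReal_nonneg measureReal_nonneg
  have h3 : u.line x - 1 ≤ √(u.superlevel ℓ 1 * (u.energyMeasure ℓ w).real univ) := by
    refine Real.le_sqrt_of_sq_le (le_trans ?_ (hb.trans h2))
    nlinarith [sq_nonneg (u.line x - 1)]
  linarith

theorem isLUB_supValue (h : Rearrangeable ℓ u w) :
    IsLUB (range u.line ∪ u.pendant '' Icc 0 ℓ) (u.supValue ℓ) :=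
  isLUB_csSup ⟨u.line 0, Or.inl ⟨0, rfl⟩⟩ h.bddAbove

theorem line_le_supValue (h : Rearrangeable ℓ u w) (x : ℝ) : u.line x ≤ u.supValue ℓ :=
  h.isLUB_supValue.1 (Or.inl ⟨x, rfl⟩)

theorem pendant_le_supValue (h : Rearrangeable ℓ u w) {x : ℝ} (hx : x ∈ Icc 0 ℓ) :
    u.pendant x ≤ u.supValue ℓ :=
  h.isLUB_supValue.1 (Or.inr ⟨x, hx, rfl⟩)

theorem supValue_pos (h : Rearrangeable ℓ u w) : 0 < u.supValue ℓ :=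
  (h.line_pos 0).trans_le (h.line_le_supValue 0)

/-- The line has a point at or below t₁, and some point of the graph lies above any given t < t₂. A
path joining them, through the junction if needed, crosses the strip. -/
theorem stripBound_one (h : Rearrangeable ℓ u w) (h1 : 0 < t₁) (h12 : t₁ ≤ t₂)
    (h2 : t₂ ≤ u.supValue ℓ) : StripBound ℓ u w 1 t₁ t₂ := by
  refine h.stripBound_of_forall_le h1 h12 zero_le_one fun t ht ht' => ?_
  rw [one_mul]
  have hfin : u.levelMeasure ℓ (Ioo t₁ t) ≠ ⊤ := h.subset_lt_top h1 Ioo_subset_Ioi_self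
  obtain ⟨x, -, hx⟩ := h.exists_line_le_of_volume_eq_top h1 Real.volume_univ
  obtain ⟨s, hs, hts, -⟩ := h.isLUB_supValue.exists_between (ht'.trans_le h2)
  rcases hs with ⟨y, rfl⟩ | ⟨y, hy, rfl⟩
  · exact h.slope.sub_le_slopeIntegral_of_line h.length_pos.le ht.le hfin hx hts.le
  · exact h.slope.sub_le_slopeIntegral_of_pendant ht.le hfin hy hx hts.le

theorem superlevel_sub (h : Rearrangeable ℓ u w) (h1 : 0 < t₁) (h12 : t₁ ≤ t₂) :
    u.superlevel ℓ t₁ - u.superlevel ℓ t₂ = (u.levelMeasure ℓ).real (Ioc t₁ t₂) := by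
  have hd : Disjoint (Ioc t₁ t₂) (Ioi t₂) :=
    disjoint_left.2 fun x hx hx' => (not_lt_of_ge hx.2) hx'
  rw [superlevel, superlevel, ← Ioc_union_Ioi_eq_Ioi h12, measureReal_union hd measurableSet_Ioi
    (h.subset_lt_top h1 Ioc_subset_Ioi_self) (h.level_lt_top t₂ (h1.trans_le h12))]
  ring

/-- A strip of zero length would contradict `stripBound_one`: values of u cannot be skipped. -/
theorem superlevel_strictAntiOn (h : Rearrangeable ℓ u w) :
    StrictAntiOn (u.superlevel ℓ) (Ioc 0 (u.supValue ℓ)) := by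
  intro t₁ h1 t₂ h2 h12
  have hb := h.stripBound_one h1.1 h12.le h2.2
  rw [StripBound, one_mul] at hb
  have hpos : 0 < (u.levelMeasure ℓ).real (Ioo t₁ t₂) := by
    refine lt_of_le_of_ne measureReal_nonneg fun h0 => ?_
    rw [← h0, zero_mul] at hb
    have : 0 < (t₂ - t₁) ^ 2 := pow_pos (sub_pos.2 h12) 2
    linarith
  have := measureReal_mono (μ := u.levelMeasure ℓ) (show Ioo t₁ t₂ ⊆ Ioc t₁ t₂ from Ioo_subset_Ioc_self)
    (h.subset_lt_top h1.1 Ioc_subset_Ioi_self)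
  rw [← h.superlevel_sub h1.1 h12.le] at this
  linarith

theorem superlevel_antitone (h : Rearrangeable ℓ u w) (h1 : 0 < t₁) (h12 : t₁ ≤ t₂) :
    u.superlevel ℓ t₂ ≤ u.superlevel ℓ t₁ :=
  measureReal_mono (Ioi_subset_Ioi h12) (h.level_lt_top t₁ h1)

theorem levelMeasure_Ioi_eq_zero (h : Rearrangeable ℓ u w) {t : ℝ} (ht : u.supValue ℓ ≤ t) :
    u.levelMeasure ℓ (Ioi t) = 0 := by
  rw [h.slope.levelMeasure_apply measurableSet_Ioi, add_eq_zero]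
  constructor
  · convert measure_empty (μ := volume)
    exact eq_empty_of_forall_notMem fun x hx =>
      (not_lt_of_ge ((h.line_le_supValue x).trans ht)) hx
  · convert measure_empty (μ := volume)
    exact eq_empty_of_forall_notMem fun x hx =>
      (not_lt_of_ge ((h.pendant_le_supValue hx.1).trans ht)) hx.2

theorem superlevel_supValue (h : Rearrangeable ℓ u w) : u.superlevel ℓ (u.supValue ℓ) = 0 := by
  rw [superlevel, Measure.real, h.levelMeasure_Ioi_eq_zero le_rfl, ENNReal.toReal_zero]

theorem continuousOn_superlevel (h : Rearrangeable ℓ u w) {ε : ℝ} (hε : 0 < ε) (b : ℝ) :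
    ContinuousOn (u.superlevel ℓ) (Icc ε b) := by
  -- Only positive levels are known to be null, so the restriction is what makes the measure
  -- atomless.
  set m := (u.levelMeasure ℓ).restrict (Ioi 0) with hm
  have hatom : NullSingletonClass m := ⟨fun x => by
    rw [hm, Measure.restrict_apply (measurableSet_singleton x)]
    rcases le_or_gt x 0 with hx | hx
    · convert measure_empty (μ := u.levelMeasure ℓ)
      exact eq_empty_of_forall_notMem fun y hy => by
        rw [mem_inter_iff, mem_singleton_iff, mem_Ioi] at hy
        linarith
    · exact measure_mono_null inter_subset_left (h.level_null x hx)⟩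
  have hint : IntegrableOn (fun _ : ℝ => (1 : ℝ)) (Icc ε b) m := by
    refine integrableOn_const (((Measure.restrict_apply_le _ _).trans_lt ?_).ne)
    exact (h.subset_lt_top (half_pos hε) fun x hx => (half_lt_self hε).trans_le hx.1).lt_top
  have hc := intervalIntegral.continuousOn_primitive hint
  refine (continuousOn_const.sub hc).congr (f := fun x => u.superlevel ℓ ε - _) fun x hx => ?_
  simp only
  rw [setIntegral_const, smul_eq_mul, mul_one, Measure.real, hm,
    Measure.restrict_apply measurableSet_Ioc,
    inter_eq_left.2 (Ioc_subset_Ioi_self.trans (Ioi_subset_Ioi hε.le)), ← Measure.real,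
    ← h.superlevel_sub hε hx.1]
  ring

/-- Since u > 0, the superlevel sets exhaust a graph of infinite length; continuity from below
applies. -/
theorem exists_lt_superlevel (h : Rearrangeable ℓ u w) {s : ℝ} (hs : 0 ≤ s) :
    ∃ t, 0 < t ∧ s < u.superlevel ℓ t := by
  have hmono : Monotone fun n : ℕ => Ioi ((1 : ℝ) / (n + 1)) := fun m n hmn =>
    Ioi_subset_Ioi (one_div_le_one_div_of_le (by positivity) (by exact_mod_cast Nat.succ_le_succ hmn))
  have ht := tendsto_measure_iUnion_atTop (μ := u.levelMeasure ℓ) hmono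
  have hU : (⋃ n : ℕ, Ioi ((1 : ℝ) / (n + 1))) = Ioi 0 := by
    ext x
    simp only [mem_iUnion, mem_Ioi]
    exact ⟨fun ⟨n, hn⟩ => lt_trans (by positivity) hn, fun hx => exists_nat_one_div_lt hx⟩
  have htop : u.levelMeasure ℓ (Ioi 0) = ⊤ := by
    rw [h.slope.levelMeasure_apply measurableSet_Ioi,
      show u.line ⁻¹' Ioi 0 = univ from eq_univ_of_forall h.line_pos, Real.volume_univ, top_add]
  rw [hU, htop] at ht
  obtain ⟨n, hn⟩ := (ht.eventually (lt_mem_nhds (ENNReal.ofReal_lt_top (r := s)))).exists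
  have hpos : (0 : ℝ) < 1 / (n + 1) := by positivity
  exact ⟨1 / (n + 1), hpos, (ENNReal.ofReal_lt_iff_lt_toReal hs (h.level_lt_top _ hpos)).1 hn⟩

theorem exists_superlevel_eq (h : Rearrangeable ℓ u w) {s : ℝ} (hs : 0 ≤ s) :
    ∃ t, 0 < t ∧ t ≤ u.supValue ℓ ∧ u.superlevel ℓ t = s := by
  obtain ⟨ε, hε, hsε⟩ := h.exists_lt_superlevel hs
  have hεM : ε ≤ u.supValue ℓ := by
    by_contra! hc
    have := h.superlevel_antitone h.supValue_pos hc.le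
    rw [h.superlevel_supValue] at this
    linarith
  obtain ⟨t, ht, hts⟩ := intermediate_value_Icc' hεM (h.continuousOn_superlevel hε _)
    (show s ∈ Icc _ _ from ⟨h.superlevel_supValue.trans_le hs, hsε.le⟩)
  exact ⟨t, hε.trans_le ht.1, ht.2, hts⟩

end Rearrangeable

end PendantFun

/-! ### The decreasing rearrangement and its increment bounds. -/

namespace PendantFun

/-- `F` is the decreasing rearrangement of `u` on the half-line. -/
structure IsDecreasingRearrangement (ℓ : ℝ) (u : PendantFun) (F : ℝ → ℝ) : Prop where
  pos : ∀ s, 0 ≤ s → 0 < F s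
  le_supValue : ∀ s, 0 ≤ s → F s ≤ u.supValue ℓ
  superlevel_eq : ∀ s, 0 ≤ s → u.superlevel ℓ (F s) = s

theorem Rearrangeable.exists_isDecreasingRearrangement {ℓ : ℝ} {u w : PendantFun}
    (h : Rearrangeable ℓ u w) : ∃ F, IsDecreasingRearrangement ℓ u F := by
  choose! F hF using fun s (hs : 0 ≤ s) => h.exists_superlevel_eq hs
  exact ⟨F, fun s hs => (hF s hs).1, fun s hs => (hF s hs).2.1, fun s hs => (hF s hs).2.2⟩

/-- The hybrid rearrangement: increasing on the pendant, symmetric decreasing on the line. -/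
def hybrid (ℓ : ℝ) (F : ℝ → ℝ) : PendantFun :=
  ⟨fun x => F (ℓ + 2 * |x|), fun x => F (ℓ - x)⟩

namespace IsDecreasingRearrangement

variable {ℓ t k : ℝ} {u w : PendantFun} {F : ℝ → ℝ}

theorem strictAntiOn (hF : IsDecreasingRearrangement ℓ u F) (h : Rearrangeable ℓ u w) :
    StrictAntiOn F (Ici 0) := by
  intro s hs r hr hsr
  by_contra! hc
  have := h.superlevel_antitone (hF.pos s hs) hc
  rw [hF.superlevel_eq s hs, hF.superlevel_eq r hr] at this
  exact hsr.not_ge this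

theorem apply_superlevel (hF : IsDecreasingRearrangement ℓ u F) (h : Rearrangeable ℓ u w)
    (ht : 0 < t) (htM : t ≤ u.supValue ℓ) : F (u.superlevel ℓ t) = t :=
  h.superlevel_strictAntiOn.injOn ⟨hF.pos _ measureReal_nonneg, hF.le_supValue _ measureReal_nonneg⟩
    ⟨ht, htM⟩ (hF.superlevel_eq _ measureReal_nonneg)

theorem lt_iff (hF : IsDecreasingRearrangement ℓ u F) (h : Rearrangeable ℓ u w) {s : ℝ}
    (hs : 0 ≤ s) (ht : 0 < t) : t < F s ↔ s < u.superlevel ℓ t := by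
  constructor
  · intro hlt
    have := h.superlevel_strictAntiOn ⟨ht, hlt.le.trans (hF.le_supValue s hs)⟩
      ⟨hF.pos s hs, hF.le_supValue s hs⟩ hlt
    rwa [hF.superlevel_eq s hs] at this
  · intro hlt
    by_contra! hc
    have := h.superlevel_antitone (hF.pos s hs) hc
    rw [hF.superlevel_eq s hs] at this
    exact hlt.not_ge this

/-- The strip between F r and F s has length exactly r - s, which turns a strip bound into an
increment bound for F. -/
theorem sq_sub_le (hF : IsDecreasingRearrangement ℓ u F) (h : Rearrangeable ℓ u w) {s r : ℝ}
    (hs : 0 ≤ s) (hsr : s ≤ r) (hb : StripBound ℓ u w k (F r) (F s)) :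
    (k * (F s - F r)) ^ 2 ≤ (r - s) *
      ((u.energyMeasure ℓ w).real (Ioi (F r)) - (u.energyMeasure ℓ w).real (Ioi (F s))) := by
  have := h.slope.isFiniteMeasure_energyMeasure (ℓ := ℓ)
  have hr := hs.trans hsr
  have hle : F r ≤ F s := (hF.strictAntiOn h).antitoneOn hs hr hsr
  have e1 : r - s = (u.levelMeasure ℓ).real (Ioc (F r) (F s)) := by
    rw [← h.superlevel_sub (hF.pos r hr) hle, hF.superlevel_eq r hr, hF.superlevel_eq s hs]
  have e2 : (u.energyMeasure ℓ w).real (Ioi (F r)) - (u.energyMeasure ℓ w).real (Ioi (F s)) =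
      (u.energyMeasure ℓ w).real (Ioc (F r) (F s)) := by
    have hd : Disjoint (Ioc (F r) (F s)) (Ioi (F s)) :=
      disjoint_left.2 fun x hx hx' => (not_lt_of_ge hx.2) hx'
    rw [← Ioc_union_Ioi_eq_Ioi hle, measureReal_union hd measurableSet_Ioi]
    ring
  rw [e1, e2]
  exact hb.trans (mul_le_mul (measureReal_mono Ioo_subset_Ioc_self
    (h.subset_lt_top (hF.pos r hr) Ioc_subset_Ioi_self)) (measureReal_mono Ioo_subset_Ioc_self)
    measureReal_nonneg measureReal_nonneg)

/-- The energy above the level of the hybrid rearrangement on the pendant, with a sign. -/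
theorem monotoneOn_energy_pendant (hF : IsDecreasingRearrangement ℓ u F)
    (h : Rearrangeable ℓ u w) :
    MonotoneOn (fun x => -(u.energyMeasure ℓ w).real (Ioi (F (ℓ - x)))) (Icc 0 ℓ) := by
  have := h.slope.isFiniteMeasure_energyMeasure (ℓ := ℓ)
  intro x hx y hy hxy
  refine neg_le_neg (measureReal_mono (Ioi_subset_Ioi ?_))
  exact (hF.strictAntiOn h).antitoneOn (sub_nonneg.2 hy.2) (sub_nonneg.2 hx.2) (by linarith)

/-- The factor k and the subinterval are free: k = 1 on [0, ℓ] gives the energy inequality, k = 2 on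
a subinterval gives its strictness. -/
theorem sqIncrementBound_pendant (hF : IsDecreasingRearrangement ℓ u F)
    (h : Rearrangeable ℓ u w) {a b : ℝ} (hb : b ≤ ℓ)
    (hk : ∀ t₁ t₂, F (ℓ - a) ≤ t₁ → t₁ ≤ t₂ → t₂ ≤ F (ℓ - b) → StripBound ℓ u w k t₁ t₂) :
    SqIncrementBound (fun x => k * F (ℓ - x))
      (fun x => -(u.energyMeasure ℓ w).real (Ioi (F (ℓ - x)))) a b := by
  intro x hx y hy hxy
  have hA := (hF.strictAntiOn h).antitoneOn
  have hmem : ∀ z ≤ b, ℓ - z ∈ Ici (0 : ℝ) := fun z hz => sub_nonneg.2 (hz.trans hb)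
  have := hF.sq_sub_le h (k := k) (hmem y hy.2) (sub_le_sub_left hxy ℓ)
    (hk _ _ (hA (hmem x hx.2) (hmem a (hx.1.trans hx.2)) (sub_le_sub_left hx.1 ℓ))
      (hA (hmem y hy.2) (hmem x hx.2) (sub_le_sub_left hxy ℓ))
      (hA (hmem b le_rfl) (hmem y hy.2) (sub_le_sub_left hy.2 ℓ)))
  nlinarith

theorem sqIncrementBound_pendant_one (hF : IsDecreasingRearrangement ℓ u F)
    (h : Rearrangeable ℓ u w) : SqIncrementBound (fun x => F (ℓ - x))
      (fun x => -(u.energyMeasure ℓ w).real (Ioi (F (ℓ - x)))) 0 ℓ := by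
  have hℓ := h.length_pos.le
  have := hF.sqIncrementBound_pendant h (k := 1) (a := 0) le_rfl fun t₁ t₂ h1 h12 h2 =>
    h.stripBound_one ((hF.pos _ (by linarith)).trans_le h1) h12
      (h2.trans (hF.le_supValue _ (by linarith)))
  simpa only [one_mul] using this

/-- Below the threshold every level is attained on the line. -/
theorem exists_lt_line (hF : IsDecreasingRearrangement ℓ u F) (h : Rearrangeable ℓ u w)
    (ht : t < F ℓ) : ∃ x, t < u.line x := by
  have hℓ := h.length_pos.le
  rcases le_or_gt t 0 with h0 | h0
  · exact ⟨0, h0.trans_lt (h.line_pos 0)⟩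
  by_contra! hc
  have h1 := (hF.lt_iff h hℓ h0).1 ht
  have h2 : u.levelMeasure ℓ (Ioi t) ≤ ENNReal.ofReal ℓ := by
    rw [h.slope.levelMeasure_apply measurableSet_Ioi,
      show u.line ⁻¹' Ioi t = ∅ from eq_empty_of_forall_notMem fun x hx => (hc x).not_gt hx,
      measure_empty, zero_add]
    exact (measure_mono inter_subset_left).trans (by rw [Real.volume_Icc, sub_zero])
  exact h1.not_ge (ENNReal.toReal_le_of_le_ofReal hℓ h2)

/-- Double crossing puts a factor 4 on the left, while the length variable advances by 2 (r - s).
After division, each half-line is charged half of the energy. -/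
theorem sq_sub_le_line (hF : IsDecreasingRearrangement ℓ u F) (h : Rearrangeable ℓ u w)
    {s r : ℝ} (hs : 0 ≤ s) (hsr : s ≤ r) :
    (F (ℓ + 2 * s) - F (ℓ + 2 * r)) ^ 2 ≤ (r - s) *
      ((u.energyMeasure ℓ w).real (Ioi (F (ℓ + 2 * r))) / 2 -
        (u.energyMeasure ℓ w).real (Ioi (F (ℓ + 2 * s))) / 2) := by
  have hℓ := h.length_pos.le
  have hA := (hF.strictAntiOn h).antitoneOn
  have m0 : ℓ ∈ Ici (0 : ℝ) := hℓ
  have ms : ℓ + 2 * s ∈ Ici (0 : ℝ) := show 0 ≤ ℓ + 2 * s by linarith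
  have mr : ℓ + 2 * r ∈ Ici (0 : ℝ) := show 0 ≤ ℓ + 2 * r by linarith
  have hb : StripBound ℓ u w 2 (F (ℓ + 2 * r)) (F (ℓ + 2 * s)) :=
    h.stripBound_two_of_line (hF.pos _ mr) (hA ms mr (by linarith)) fun t ht =>
      hF.exists_lt_line h (ht.trans_le (hA m0 ms (by linarith)))
  have := hF.sq_sub_le h ms (by linarith) hb
  nlinarith

/-- The energy between the level of the hybrid rearrangement on the line and the threshold,
split evenly among the two half-lines. -/
noncomputable def lineEnergy (ℓ : ℝ) (u w : PendantFun) (F : ℝ → ℝ) (x : ℝ) : ℝ :=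
  if x < 0 then -((u.energyMeasure ℓ w).real (Ioi (F (ℓ + 2 * |x|))) / 2 -
      (u.energyMeasure ℓ w).real (Ioi (F ℓ)) / 2)
  else (u.energyMeasure ℓ w).real (Ioi (F (ℓ + 2 * |x|))) / 2 -
      (u.energyMeasure ℓ w).real (Ioi (F ℓ)) / 2

theorem monotone_energy (hF : IsDecreasingRearrangement ℓ u F) (h : Rearrangeable ℓ u w)
    {s r : ℝ} (hs : 0 ≤ s) (hsr : s ≤ r) :
    (u.energyMeasure ℓ w).real (Ioi (F (ℓ + 2 * s))) ≤
      (u.energyMeasure ℓ w).real (Ioi (F (ℓ + 2 * r))) := by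
  have := h.slope.isFiniteMeasure_energyMeasure (ℓ := ℓ)
  have hℓ := h.length_pos.le
  refine measureReal_mono (Ioi_subset_Ioi ?_)
  exact (hF.strictAntiOn h).antitoneOn (show 0 ≤ ℓ + 2 * s by linarith)
    (show 0 ≤ ℓ + 2 * r by linarith) (by linarith)

theorem monotone_lineEnergy (hF : IsDecreasingRearrangement ℓ u F) (h : Rearrangeable ℓ u w) :
    Monotone (lineEnergy ℓ u w F) := by
  have h0 : ∀ x, (u.energyMeasure ℓ w).real (Ioi (F ℓ)) ≤
      (u.energyMeasure ℓ w).real (Ioi (F (ℓ + 2 * |x|))) := fun x => by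
    have := hF.monotone_energy h le_rfl (abs_nonneg x)
    rwa [mul_zero, add_zero] at this
  intro x y hxy
  have hx := h0 x
  have hy := h0 y
  rw [lineEnergy, lineEnergy]
  split_ifs with h1 h2 h2
  · have := hF.monotone_energy h (abs_nonneg y) (r := |x|)
      (by rw [abs_of_neg h1, abs_of_neg h2]; linarith)
    linarith
  · linarith
  · linarith
  · have := hF.monotone_energy h (abs_nonneg x) (r := |y|)
      (by rw [abs_of_nonneg (not_lt.1 h1), abs_of_nonneg (not_lt.1 h2)]; linarith)
    linarith

theorem sqIncrementBound_line (hF : IsDecreasingRearrangement ℓ u F) (h : Rearrangeable ℓ u w)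
    (a b : ℝ) : SqIncrementBound (fun x => F (ℓ + 2 * |x|)) (lineEnergy ℓ u w F) a b := by
  have h0 : ∀ x, (u.energyMeasure ℓ w).real (Ioi (F ℓ)) ≤
      (u.energyMeasure ℓ w).real (Ioi (F (ℓ + 2 * |x|))) := fun x => by
    have := hF.monotone_energy h le_rfl (abs_nonneg x)
    rwa [mul_zero, add_zero] at this
  intro x _ y _ hxy
  have hx := h0 x
  have hy := h0 y
  change (F (ℓ + 2 * |x|) - F (ℓ + 2 * |y|)) ^ 2 ≤ _
  rw [lineEnergy, lineEnergy]
  split_ifs with h2 h1 h1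
  · have hle : |y| ≤ |x| := by rw [abs_of_neg h1, abs_of_neg h2]; linarith
    have := hF.sq_sub_le_line h (abs_nonneg y) hle
    have e : |x| - |y| = y - x := by rw [abs_of_neg h1, abs_of_neg h2]; ring
    rw [e] at this
    linarith
  · linarith
  -- Here x < 0 ≤ y. By evenness only |x| and |y| matter; their difference is at most y - x, and the
  -- energies charged to the two half-lines add up.
  · have hy0 := abs_of_nonneg (not_lt.1 h2)
    have hx0 := abs_of_neg h1
    rcases le_total |x| |y| with hle | hle
    · refine ((hF.sq_sub_le_line h (abs_nonneg x) hle).trans ?_)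
      refine mul_le_mul (by linarith [abs_nonneg x]) (by linarith)
        (by linarith [hF.monotone_energy h (abs_nonneg x) hle]) (by linarith)
    · rw [sub_sq_comm]
      refine ((hF.sq_sub_le_line h (abs_nonneg y) hle).trans ?_)
      refine mul_le_mul (by linarith [abs_nonneg y]) (by linarith)
        (by linarith [hF.monotone_energy h (abs_nonneg y) hle]) (by linarith)
  · have e1 := abs_of_nonneg (not_lt.1 h1)
    have e2 := abs_of_nonneg (not_lt.1 h2)
    have hle : |x| ≤ |y| := by rw [e1, e2]; exact hxy
    have := hF.sq_sub_le_line h (abs_nonneg x) hle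
    rw [e1, e2] at this ⊢
    linarith

end IsDecreasingRearrangement

end PendantFun

/-! ### Passing between H¹ functions, primitives and increment bounds. -/

theorem IsPrimitive.isWeakDeriv {U : Set ℝ} (hU : IsOpen U) {f f' g : ℝ → ℝ}
    (h : IsPrimitive f g) (heq : EqOn f' f U) : IsWeakDeriv U f' g :=
  isWeakDeriv_of_eq_primitive hU h.locallyIntegrable fun x hx => by
    rw [heq hx, h.eq_primitive]

theorem IsPrimitive.memH1 {U : Set ℝ} (hU : IsOpen U) {f f' g : ℝ → ℝ}
    (h : IsPrimitive f g) (heq : EqOn f' f U) (hL : MemLp f' 2 (volume.restrict U)) :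
    MemH1 U f' :=
  ⟨hL, g, h.isWeakDeriv hU heq, h.memLp.restrict U⟩

theorem IsPrimitive.integral_sq_weakDeriv {U : Set ℝ} (hU : IsOpen U) {f f' g : ℝ → ℝ}
    (h : IsPrimitive f g) (heq : EqOn f' f U) :
    ∫ x in U, |weakDeriv U f' x| ^ 2 = ∫ x in U, g x ^ 2 := by
  refine integral_congr_ae ?_
  filter_upwards [(h.isWeakDeriv hU heq).weakDeriv_ae_eq hU] with x hx
  rw [hx, sq_abs]

/-- A continuous `H¹` function on an interval extends to a primitive. -/
theorem MemH1.exists_isPrimitive {U : Set ℝ} (hU : IsOpen U) (hconn : U.OrdConnected)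
    (hne : U.Nonempty) {f : ℝ → ℝ} (hf : MemH1 U f) (hc : ContinuousOn f (closure U)) :
    ∃ F g, IsPrimitive F g ∧ EqOn f F (closure U) := by
  obtain ⟨-, g, hg, hg2⟩ := hf
  have hL : MemLp (U.indicator g) 2 volume := (memLp_indicator_iff_restrict hU.measurableSet).2 hg2
  have hloc : LocallyIntegrable (U.indicator g) := hL.locallyIntegrable (by norm_num)
  have hae : g =ᵐ[volume.restrict U] U.indicator g := by
    rw [Filter.EventuallyEq, ae_restrict_iff' hU.measurableSet]
    exact Filter.Eventually.of_forall fun x hx => (indicator_of_mem hx g).symm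
  have hW : IsWeakDeriv U f (U.indicator g) := by
    refine ⟨hg.locallyIntegrableOn, hloc.locallyIntegrableOn U, fun η hη hc hs => ?_⟩
    rw [hg.integral_eq η hη hc hs]
    congr 1
    refine integral_congr_ae ?_
    filter_upwards [hae] with x hx
    rw [← hx]
  obtain ⟨c, hcF⟩ := hW.exists_eq_primitive hU hconn hne hloc hc
  refine ⟨fun x => c + ∫ t in (0 : ℝ)..x, U.indicator g t, U.indicator g, ⟨hL, fun x y => ?_⟩, hcF⟩
  have hi : ∀ a b, IntervalIntegrable (U.indicator g) volume a b := fun a b =>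
    (hloc.integrableOn_isCompact isCompact_uIcc).intervalIntegrable
  rw [add_sub_add_left_eq_sub, intervalIntegral.integral_interval_sub_left (hi _ _) (hi _ _)]

/-- The derivative is set to zero outside (a, b], so that it is square integrable on all of ℝ as
`IsPrimitive` demands. -/
theorem SqIncrementBound.exists_isPrimitive {f Γ : ℝ → ℝ} {a b : ℝ} (hab : a ≤ b)
    (hΓ : MonotoneOn Γ (Icc a b)) (h : SqIncrementBound f Γ a b) :
    ∃ F g, IsPrimitive F g ∧ EqOn f F (Icc a b) ∧
      ∫ x in Ioo a b, g x ^ 2 = ∫ x in a..b, deriv f x ^ 2 := by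
  have hsq := (h.integral_sq_deriv_le hab hΓ).1
  rw [intervalIntegrable_iff_integrableOn_Ioc_of_le hab] at hsq
  have hL : MemLp ((Ioc a b).indicator (deriv f)) 2 volume := by
    rw [memLp_indicator_iff_restrict measurableSet_Ioc]
    exact (memLp_two_iff_integrable_sq (measurable_deriv f).aestronglyMeasurable).2 hsq
  have hi : ∀ x y, IntervalIntegrable ((Ioc a b).indicator (deriv f)) volume x y := fun x y =>
    ((hL.locallyIntegrable (by norm_num)).integrableOn_isCompact isCompact_uIcc).intervalIntegrable
  refine ⟨fun x => f a + ∫ t in a..x, (Ioc a b).indicator (deriv f) t, _,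
    ⟨hL, fun x y => ?_⟩, fun x hx => ?_, ?_⟩
  · rw [add_sub_add_left_eq_sub, intervalIntegral.integral_interval_sub_left (hi _ _) (hi _ _)]
  · have hs : Icc a x ⊆ Icc a b := Icc_subset_Icc le_rfl hx.2
    have := (h.mono hs).integral_deriv_eq_sub hx.1 (hΓ.mono hs)
    have e : ∫ t in a..x, (Ioc a b).indicator (deriv f) t = ∫ t in a..x, deriv f t := by
      refine intervalIntegral.integral_congr_ae (Filter.Eventually.of_forall fun t ht => ?_)
      rw [uIoc_of_le hx.1] at ht
      exact indicator_of_mem (Ioc_subset_Ioc le_rfl hx.2 ht) _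
    simp only [e, this]
    ring
  · rw [intervalIntegral.integral_of_le hab, integral_Ioc_eq_integral_Ioo]
    refine setIntegral_congr_fun measurableSet_Ioo fun t ht => ?_
    simp only [indicator_of_mem (Ioo_subset_Ioc_self ht)]

/-- The bounds on [-n, n] are uniform in n, so square integrability follows by exhaustion. -/
theorem isPrimitive_deriv_of_sqIncrementBound {f Γ : ℝ → ℝ} {C : ℝ} (hΓ : Monotone Γ)
    (h : ∀ a b, SqIncrementBound f Γ a b) (hC : ∀ a b, Γ b - Γ a ≤ C) :
    IsPrimitive f (deriv f) ∧ ∫ x, deriv f x ^ 2 ≤ C := by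
  have hb : ∀ a b, a ≤ b → IntervalIntegrable (fun x => deriv f x ^ 2) volume a b ∧
      ∫ x in a..b, deriv f x ^ 2 ≤ C := fun a b hab =>
    ⟨((h a b).integral_sq_deriv_le hab (hΓ.monotoneOn _)).1,
      ((h a b).integral_sq_deriv_le hab (hΓ.monotoneOn _)).2.trans (hC a b)⟩
  have hsub : ∀ n : ℕ, -(n : ℝ) ≤ n := fun n => by
    have : (0 : ℝ) ≤ n := n.cast_nonneg
    linarith
  have ta : Filter.Tendsto (fun n : ℕ => -(n : ℝ)) Filter.atTop Filter.atBot :=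
    Filter.tendsto_neg_atTop_atBot.comp tendsto_natCast_atTop_atTop
  have tb : Filter.Tendsto (fun n : ℕ => (n : ℝ)) Filter.atTop Filter.atTop :=
    tendsto_natCast_atTop_atTop
  have hint : Integrable (fun x => deriv f x ^ 2) := by
    refine integrable_of_intervalIntegral_norm_bounded C (fun n : ℕ =>
      (intervalIntegrable_iff_integrableOn_Ioc_of_le (hsub n)).1 (hb _ _ (hsub n)).1) ta tb
      (Filter.Eventually.of_forall fun n => ?_)
    refine le_trans (le_of_eq ?_) (hb _ _ (hsub n)).2
    refine intervalIntegral.integral_congr fun x _ => ?_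
    exact (Real.norm_eq_abs _).trans (abs_of_nonneg (sq_nonneg _))
  refine ⟨⟨(memLp_two_iff_integrable_sq (measurable_deriv f).aestronglyMeasurable).2 hint,
    fun x y => ?_⟩, ?_⟩
  · rcases le_total x y with hxy | hxy
    · exact ((h x y).integral_deriv_eq_sub hxy (hΓ.monotoneOn _)).symm
    · rw [intervalIntegral.integral_symm,
        (h y x).integral_deriv_eq_sub hxy (hΓ.monotoneOn _), neg_sub]
  · exact le_of_tendsto (intervalIntegral_tendsto_integral hint ta tb)
      (Filter.Eventually.of_forall fun n => (hb _ _ (hsub n)).2)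

/-! ### Equimeasurability and Lebesgue norms. -/

theorem lintegral_rpow_congr_of_measure_Ioi {m m' : Measure ℝ} (h0 : ∀ᵐ t ∂m, 0 ≤ t)
    (h0' : ∀ᵐ t ∂m', 0 ≤ t) (h : ∀ t, 0 < t → m (Ioi t) = m' (Ioi t)) {q : ℝ} (hq : 0 < q) :
    ∫⁻ t, ENNReal.ofReal (t ^ q) ∂m = ∫⁻ t, ENNReal.ofReal (t ^ q) ∂m' := by
  have e1 := lintegral_rpow_eq_lintegral_meas_lt_mul m (f := fun t => t) h0 aemeasurable_id hq
  have e2 := lintegral_rpow_eq_lintegral_meas_lt_mul m' (f := fun t => t) h0' aemeasurable_id hq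
  rw [e1, e2]
  congr 1
  exact setLIntegral_congr_fun measurableSet_Ioi fun t ht => by
    show m (Ioi t) * _ = m' (Ioi t) * _
    rw [h t ht]

namespace PendantFun

variable {ℓ q : ℝ} {u v : PendantFun}

/-- Positivity together with measurability on both branches. -/
structure PosMeasurable (ℓ : ℝ) (u : PendantFun) : Prop where
  line : AEMeasurable u.line volume
  pendant : AEMeasurable u.pendant (volume.restrict (Icc 0 ℓ))
  pos : u.Pos ℓ

theorem PosMeasurable.ae_pos (h : PosMeasurable ℓ u) : ∀ᵐ t ∂(u.levelMeasure ℓ), 0 < t := by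
  rw [levelMeasure, ae_add_measure_iff, ae_map_iff h.line measurableSet_Ioi,
    ae_map_iff h.pendant measurableSet_Ioi, ae_restrict_iff' measurableSet_Icc]
  exact ⟨Filter.Eventually.of_forall h.pos.1, Filter.Eventually.of_forall h.pos.2⟩

theorem PosMeasurable.ae_nonneg (h : PosMeasurable ℓ u) : ∀ᵐ t ∂(u.levelMeasure ℓ), 0 ≤ t :=
  h.ae_pos.mono fun _ => le_of_lt

theorem PosMeasurable.lintegral_rpow (h : PosMeasurable ℓ u) (q : ℝ) :
    ∫⁻ t, ENNReal.ofReal (t ^ q) ∂(u.levelMeasure ℓ) =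
      (∫⁻ x, ENNReal.ofReal (|u.line x| ^ q)) +
        ∫⁻ x in Ioo 0 ℓ, ENNReal.ofReal (|u.pendant x| ^ q) := by
  have hm : Measurable fun t : ℝ => ENNReal.ofReal (t ^ q) := by fun_prop
  rw [levelMeasure, lintegral_add_measure, lintegral_map' hm.aemeasurable h.line,
    lintegral_map' hm.aemeasurable h.pendant, restrict_Ioo_eq_restrict_Icc]
  congr 1
  · exact lintegral_congr fun x => by rw [abs_of_pos (h.pos.1 x)]
  · exact setLIntegral_congr_fun measurableSet_Icc fun x hx => by
      simp only [abs_of_pos (h.pos.2 x hx)]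

theorem PosMeasurable.pendant_Ioo (h : PosMeasurable ℓ u) :
    AEMeasurable u.pendant (volume.restrict (Ioo 0 ℓ)) :=
  h.pendant.mono_measure (Measure.restrict_mono Ioo_subset_Icc_self le_rfl)

theorem PosMeasurable.integral_rpow (h : PosMeasurable ℓ u)
    (hfin : ∫⁻ t, ENNReal.ofReal (t ^ q) ∂(u.levelMeasure ℓ) ≠ ⊤) :
    (∫ x, |u.line x| ^ q) + ∫ x in Ioo 0 ℓ, |u.pendant x| ^ q =
      (∫⁻ t, ENNReal.ofReal (t ^ q) ∂(u.levelMeasure ℓ)).toReal := by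
  rw [h.lintegral_rpow] at hfin ⊢
  have hm : Measurable fun t : ℝ => |t| ^ q := by fun_prop
  rw [ENNReal.toReal_add (ENNReal.add_ne_top.1 hfin).1 (ENNReal.add_ne_top.1 hfin).2,
    integral_eq_lintegral_of_nonneg_ae (f := fun x => |u.line x| ^ q)
      (Filter.Eventually.of_forall fun x => by positivity)
      (hm.comp_aemeasurable h.line).aestronglyMeasurable,
    integral_eq_lintegral_of_nonneg_ae (f := fun x => |u.pendant x| ^ q)
      (Filter.Eventually.of_forall fun x => by positivity)
      (hm.comp_aemeasurable h.pendant_Ioo).aestronglyMeasurable]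

theorem PosMeasurable.memLp_iff (h : PosMeasurable ℓ u) :
    ∫⁻ t, ENNReal.ofReal (t ^ (2 : ℝ)) ∂(u.levelMeasure ℓ) ≠ ⊤ ↔
      MemLp u.line 2 volume ∧ MemLp u.pendant 2 (volume.restrict (Ioo 0 ℓ)) := by
  have key : ∀ {m : Measure ℝ} {f : ℝ → ℝ}, AEMeasurable f m →
      (∫⁻ x, ENNReal.ofReal (|f x| ^ (2 : ℝ)) ∂m ≠ ⊤ ↔ MemLp f 2 m) := by
    intro m f hf
    rw [memLp_two_iff_integrable_sq hf.aestronglyMeasurable]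
    have e : ∀ x, |f x| ^ (2 : ℝ) = f x ^ 2 := fun x => by rw [Real.rpow_two, sq_abs]
    simp only [e]
    exact (lintegral_ofReal_ne_top_iff_integrable (hf.pow_const 2).aestronglyMeasurable
      (Filter.Eventually.of_forall fun x => sq_nonneg _))
  rw [h.lintegral_rpow, ENNReal.add_ne_top, key h.line, key h.pendant_Ioo]

/-- Interpolation with the sup bound: t ^ q ≤ M ^ (q - 2) * t ^ 2. -/
theorem PosMeasurable.lintegral_rpow_ne_top (h : PosMeasurable ℓ u) {M : ℝ} (hq : 2 < q)
    (hM : ∀ᵐ t ∂(u.levelMeasure ℓ), t ≤ M)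
    (h2 : ∫⁻ t, ENNReal.ofReal (t ^ (2 : ℝ)) ∂(u.levelMeasure ℓ) ≠ ⊤) :
    ∫⁻ t, ENNReal.ofReal (t ^ q) ∂(u.levelMeasure ℓ) ≠ ⊤ := by
  have hle : ∫⁻ t, ENNReal.ofReal (t ^ q) ∂(u.levelMeasure ℓ) ≤
      ∫⁻ t, ENNReal.ofReal (M ^ (q - 2)) * ENNReal.ofReal (t ^ (2 : ℝ)) ∂(u.levelMeasure ℓ) := by
    refine lintegral_mono_ae ?_
    filter_upwards [h.ae_pos, hM] with t h0 hM
    rw [← ENNReal.ofReal_mul (Real.rpow_nonneg (h0.le.trans hM) _)]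
    refine ENNReal.ofReal_le_ofReal ?_
    calc t ^ q = t ^ (q - 2) * t ^ (2 : ℝ) := by rw [← Real.rpow_add h0]; ring_nf
      _ ≤ M ^ (q - 2) * t ^ (2 : ℝ) := mul_le_mul_of_nonneg_right
          (Real.rpow_le_rpow h0.le hM (by linarith)) (Real.rpow_nonneg h0.le _)
  rw [lintegral_const_mul _ (by fun_prop)] at hle
  exact (hle.trans_lt (ENNReal.mul_lt_top ENNReal.ofReal_lt_top h2.lt_top)).ne

theorem mass_eq (u : PendantFun) (ℓ : ℝ) :
    u.mass ℓ = (∫ x, |u.line x| ^ (2 : ℝ)) + ∫ x in Ioo 0 ℓ, |u.pendant x| ^ (2 : ℝ) := by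
  simp only [mass, Real.rpow_two]

end PendantFun

/-! ### The hybrid rearrangement: level sets, energy, and the equality case. -/

namespace PendantFun

variable {ℓ p t t₁ t₂ : ℝ} {u v w : PendantFun} {F : ℝ → ℝ}

/-- Off [0, ℓ] the pendant function is arbitrary; it is replaced there so that both branches are
primitives on ℝ. -/
theorem InH1.exists_hasSlope (hℓ : 0 < ℓ) (hu : u.InH1 ℓ) :
    ∃ U w : PendantFun, U.line = u.line ∧ EqOn u.pendant U.pendant (Icc 0 ℓ) ∧ HasSlope U w := by
  obtain ⟨φ, g, hφ, e1⟩ := hu.memH1_line.exists_isPrimitive isOpen_univ ordConnected_univ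
    univ_nonempty hu.continuous_line.continuousOn
  rw [closure_univ, eqOn_univ] at e1
  have hcl : closure (Ioo 0 ℓ) = Icc 0 ℓ := closure_Ioo hℓ.ne
  obtain ⟨ψ, k, hψ, e2⟩ := hu.memH1_pendant.exists_isPrimitive isOpen_Ioo ordConnected_Ioo
    (nonempty_Ioo.2 hℓ) (hcl ▸ hu.continuousOn_pendant)
  rw [hcl] at e2
  refine ⟨⟨u.line, ψ⟩, ⟨g, k⟩, rfl, e2, e1 ▸ hφ, hψ, ?_⟩
  rw [hu.junction, e2 (left_mem_Icc.2 hℓ.le)]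

theorem levelMeasure_congr (h1 : v.line = u.line) (h2 : EqOn u.pendant v.pendant (Icc 0 ℓ)) :
    u.levelMeasure ℓ = v.levelMeasure ℓ := by
  rw [levelMeasure, levelMeasure, h1]
  congr 1
  refine Measure.map_congr ?_
  rw [Filter.EventuallyEq, ae_restrict_iff' measurableSet_Icc]
  exact Filter.Eventually.of_forall h2

theorem energy_eq_of_isPrimitive (hm : PosMeasurable ℓ u) {g ψ k : ℝ → ℝ}
    (hl : IsPrimitive u.line g) (hp : IsPrimitive ψ k) (heq : EqOn u.pendant ψ (Icc 0 ℓ))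
    (hfin : ∫⁻ t, ENNReal.ofReal (t ^ p) ∂(u.levelMeasure ℓ) ≠ ⊤) :
    u.energy p ℓ = 1 / 2 * ((∫ x, g x ^ 2) + ∫ x in Ioo 0 ℓ, k x ^ 2) -
      1 / p * (∫⁻ t, ENNReal.ofReal (t ^ p) ∂(u.levelMeasure ℓ)).toReal := by
  have e1 := hl.integral_sq_weakDeriv isOpen_univ (f' := u.line) fun _ _ => rfl
  rw [setIntegral_univ, setIntegral_univ] at e1
  rw [energy, e1, hp.integral_sq_weakDeriv isOpen_Ioo (heq.mono Ioo_subset_Icc_self),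
    hm.integral_rpow hfin]

/-- Chebyshev's inequality for the squared norm. -/
theorem levelMeasure_Ioi_ne_top
    (h2 : ∫⁻ t, ENNReal.ofReal (t ^ (2 : ℝ)) ∂(u.levelMeasure ℓ) ≠ ⊤) (ht : 0 < t) :
    u.levelMeasure ℓ (Ioi t) ≠ ⊤ := by
  intro htop
  have h3 := mul_meas_ge_le_lintegral (μ := u.levelMeasure ℓ)
    (f := fun s : ℝ => ENNReal.ofReal (s ^ (2 : ℝ))) (by fun_prop) (ENNReal.ofReal (t ^ (2 : ℝ)))
  have h4 : u.levelMeasure ℓ (Ioi t) ≤ u.levelMeasure ℓ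
      {x | ENNReal.ofReal (t ^ (2 : ℝ)) ≤ ENNReal.ofReal (x ^ (2 : ℝ))} :=
    measure_mono fun x (hx : t < x) =>
      ENNReal.ofReal_le_ofReal (Real.rpow_le_rpow ht.le hx.le zero_le_two)
  rw [htop, top_le_iff] at h4
  rw [h4, ENNReal.mul_top (ENNReal.ofReal_pos.2 (Real.rpow_pos_of_pos ht _)).ne'] at h3
  exact h2 (top_le_iff.1 h3)

namespace Rearrangeable

theorem ofReal_superlevel (h : Rearrangeable ℓ u w) (ht : 0 < t) :
    ENNReal.ofReal (u.superlevel ℓ t) = u.levelMeasure ℓ (Ioi t) :=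
  ENNReal.ofReal_toReal (h.level_lt_top t ht)

end Rearrangeable

namespace IsDecreasingRearrangement

theorem levelMeasure_Ioi_threshold (hF : IsDecreasingRearrangement ℓ u F)
    (h : Rearrangeable ℓ u w) : u.levelMeasure ℓ (Ioi (F ℓ)) = ENNReal.ofReal ℓ := by
  have hℓ := h.length_pos.le
  rw [← h.ofReal_superlevel (hF.pos ℓ hℓ), hF.superlevel_eq ℓ hℓ]

theorem volume_pendant (hF : IsDecreasingRearrangement ℓ u F) (h : Rearrangeable ℓ u w)
    (ht : F ℓ ≤ t) :
    volume {x ∈ Icc 0 ℓ | t < F (ℓ - x)} = u.levelMeasure ℓ (Ioi t) := by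
  have hℓ := h.length_pos.le
  have h0 : 0 < t := (hF.pos ℓ hℓ).trans_le ht
  have hle : u.superlevel ℓ t ≤ ℓ := by
    have := h.superlevel_antitone (hF.pos ℓ hℓ) ht
    rwa [hF.superlevel_eq ℓ hℓ] at this
  have e : {x ∈ Icc 0 ℓ | t < F (ℓ - x)} = Ioc (ℓ - u.superlevel ℓ t) ℓ := by
    ext x
    simp only [mem_ofPred_eq, mem_Icc, mem_Ioc]
    constructor
    · rintro ⟨⟨h1, h2⟩, h3⟩
      have := (hF.lt_iff h (sub_nonneg.2 h2) h0).1 h3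
      exact ⟨by linarith, h2⟩
    · rintro ⟨h1, h2⟩
      exact ⟨⟨by linarith, h2⟩, (hF.lt_iff h (sub_nonneg.2 h2) h0).2 (by linarith)⟩
  rw [e, Real.volume_Ioc, sub_sub_cancel, h.ofReal_superlevel h0]

theorem volume_line (hF : IsDecreasingRearrangement ℓ u F) (h : Rearrangeable ℓ u w)
    (h0 : 0 < t) (ht : t ≤ F ℓ) :
    volume {x | t < F (ℓ + 2 * |x|)} = u.levelMeasure ℓ (Ioc t (F ℓ)) := by
  have hℓ := h.length_pos.le
  have e : {x | t < F (ℓ + 2 * |x|)} =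
      Ioo (-((u.superlevel ℓ t - ℓ) / 2)) ((u.superlevel ℓ t - ℓ) / 2) := by
    ext x
    rw [mem_ofPred_eq, hF.lt_iff h (by positivity) h0, mem_Ioo, ← abs_lt]
    constructor <;> intro hx <;> linarith
  have h1 := h.superlevel_sub h0 ht
  rw [hF.superlevel_eq ℓ hℓ] at h1
  rw [e, Real.volume_Ioo, ← ENNReal.ofReal_toReal (h.subset_lt_top h0
    (show Ioc t (F ℓ) ⊆ Ioi t from Ioc_subset_Ioi_self)), ← Measure.real, ← h1]
  congr 1
  ring

theorem levelMeasure_hybrid (hF : IsDecreasingRearrangement ℓ u F) (h : Rearrangeable ℓ u w)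
    (hm : PosMeasurable ℓ (hybrid ℓ F)) (h0 : 0 < t) :
    (hybrid ℓ F).levelMeasure ℓ (Ioi t) = u.levelMeasure ℓ (Ioi t) := by
  have hℓ := h.length_pos.le
  have hA := (hF.strictAntiOn h).antitoneOn
  have e0 : (hybrid ℓ F).levelMeasure ℓ (Ioi t) = volume {x | t < F (ℓ + 2 * |x|)} +
      volume {x ∈ Icc 0 ℓ | t < F (ℓ - x)} := by
    rw [levelMeasure, Measure.add_apply, Measure.map_apply_of_aemeasurable hm.line measurableSet_Ioi,
      Measure.map_apply_of_aemeasurable hm.pendant measurableSet_Ioi,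
      Measure.restrict_apply' measurableSet_Icc, inter_comm]
    rfl
  rw [e0]
  rcases le_or_gt (F ℓ) t with ht | ht
  · rw [hF.volume_pendant h ht, show {x | t < F (ℓ + 2 * |x|)} = ∅ from
      eq_empty_of_forall_notMem fun x (hx : t < F (ℓ + 2 * |x|)) => hx.not_ge ((hA hℓ
        (show 0 ≤ ℓ + 2 * |x| by positivity) (by linarith [abs_nonneg x])).trans ht),
      measure_empty, zero_add]
  · have e : {x ∈ Icc 0 ℓ | t < F (ℓ - x)} = Icc 0 ℓ := by
      refine sep_eq_self_iff_mem_true.2 fun x hx => ht.trans_le ?_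
      exact hA (sub_nonneg.2 hx.2) hℓ (sub_le_self ℓ hx.1)
    have hd : Disjoint (Ioc t (F ℓ)) (Ioi (F ℓ)) :=
      disjoint_left.2 fun x hx hx' => (not_lt_of_ge hx.2) hx'
    rw [e, hF.volume_line h h0 ht.le, Real.volume_Icc, sub_zero,
      ← hF.levelMeasure_Ioi_threshold h, ← measure_union hd measurableSet_Ioi,
      Ioc_union_Ioi_eq_Ioi ht.le]

theorem isPrimitive_line (hF : IsDecreasingRearrangement ℓ u F) (h : Rearrangeable ℓ u w) :
    IsPrimitive (hybrid ℓ F).line (deriv (hybrid ℓ F).line) ∧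
      ∫ x, deriv (hybrid ℓ F).line x ^ 2 ≤
        (u.energyMeasure ℓ w).real univ - (u.energyMeasure ℓ w).real (Ioi (F ℓ)) := by
  have := h.slope.isFiniteMeasure_energyMeasure (ℓ := ℓ)
  refine isPrimitive_deriv_of_sqIncrementBound (hF.monotone_lineEnergy h)
    (hF.sqIncrementBound_line h) fun a b => ?_
  have hle : ∀ x, (u.energyMeasure ℓ w).real (Ioi (F (ℓ + 2 * |x|))) ≤
      (u.energyMeasure ℓ w).real univ := fun x => measureReal_mono (subset_univ _)
  have hge : ∀ x, (u.energyMeasure ℓ w).real (Ioi (F ℓ)) ≤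
      (u.energyMeasure ℓ w).real (Ioi (F (ℓ + 2 * |x|))) := fun x => by
    have := hF.monotone_energy h le_rfl (abs_nonneg x)
    rwa [mul_zero, add_zero] at this
  have h1 := hle a
  have h2 := hle b
  have h3 := hge a
  have h4 := hge b
  rw [lineEnergy, lineEnergy]
  split_ifs <;> linarith

theorem exists_isPrimitive_pendant (hF : IsDecreasingRearrangement ℓ u F)
    (h : Rearrangeable ℓ u w) : ∃ ψ k, IsPrimitive ψ k ∧
      EqOn (hybrid ℓ F).pendant ψ (Icc 0 ℓ) ∧
      ∫ x in Ioo 0 ℓ, k x ^ 2 = ∫ x in (0 : ℝ)..ℓ, deriv (fun x => F (ℓ - x)) x ^ 2 :=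
  (hF.sqIncrementBound_pendant_one h).exists_isPrimitive h.length_pos.le
    (hF.monotoneOn_energy_pendant h)

theorem integral_sq_pendant_le (hF : IsDecreasingRearrangement ℓ u F) (h : Rearrangeable ℓ u w) :
    ∫ x in (0 : ℝ)..ℓ, deriv (fun x => F (ℓ - x)) x ^ 2 ≤
      (u.energyMeasure ℓ w).real (Ioi (F ℓ)) := by
  have := ((hF.sqIncrementBound_pendant_one h).integral_sq_deriv_le h.length_pos.le
    (hF.monotoneOn_energy_pendant h)).2
  simp only [sub_self, sub_zero] at this
  linarith [measureReal_nonneg (μ := u.energyMeasure ℓ w) (s := Ioi (F 0))]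

/-- F (ℓ - x) runs from t₁ to t₂ as x runs from ℓ - `superlevel` t₁ to ℓ - `superlevel` t₂. On that
interval the increment bound has the extra factor 4, so `integral_sq_deriv_lt` applies. -/
theorem integral_sq_pendant_lt (hF : IsDecreasingRearrangement ℓ u F) (h : Rearrangeable ℓ u w)
    (h1 : F ℓ ≤ t₁) (h12 : t₁ < t₂) (h2 : t₂ ≤ u.supValue ℓ)
    (hk : ∀ a b, t₁ ≤ a → a ≤ b → b ≤ t₂ → StripBound ℓ u w 2 a b) :
    ∫ x in (0 : ℝ)..ℓ, deriv (fun x => F (ℓ - x)) x ^ 2 <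
      (u.energyMeasure ℓ w).real (Ioi (F ℓ)) := by
  have hℓ := h.length_pos.le
  have p1 : 0 < t₁ := (hF.pos ℓ hℓ).trans_le h1
  have e1 := hF.apply_superlevel h p1 (h12.le.trans h2)
  have e2 := hF.apply_superlevel h (p1.trans h12) h2
  have l1 : u.superlevel ℓ t₁ ≤ ℓ := by
    have := h.superlevel_antitone (hF.pos ℓ hℓ) h1
    rwa [hF.superlevel_eq ℓ hℓ] at this
  have l2 : u.superlevel ℓ t₂ ≤ u.superlevel ℓ t₁ := h.superlevel_antitone p1 h12.le
  have l3 : 0 ≤ u.superlevel ℓ t₂ := measureReal_nonneg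
  have := (hF.sqIncrementBound_pendant_one h).integral_sq_deriv_lt
    (hF.monotoneOn_energy_pendant h) (c := ℓ - u.superlevel ℓ t₁) (d := ℓ - u.superlevel ℓ t₂)
    (by linarith) (by linarith) (by linarith)
    (hF.sqIncrementBound_pendant h (by linarith) fun a b ha hab hb => hk a b
      (by rwa [sub_sub_cancel, e1] at ha) hab (by rwa [sub_sub_cancel, e2] at hb))
    (by simp only [sub_sub_cancel, e1, e2]; exact h12.ne)
  simp only [sub_self, sub_zero] at this
  linarith [measureReal_nonneg (μ := u.energyMeasure ℓ w) (s := Ioi (F 0))]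

/-- If no strip above the threshold is covered twice, then `u` is already arranged like its
hybrid rearrangement. -/
theorem structure_of_not_stripBound (hF : IsDecreasingRearrangement ℓ u F)
    (h : Rearrangeable ℓ u w)
    (hno : ∀ t₁ t₂, F ℓ ≤ t₁ → t₁ < t₂ → t₂ ≤ u.supValue ℓ →
      ¬ ∀ a b, t₁ ≤ a → a ≤ b → b ≤ t₂ → StripBound ℓ u w 2 a b) :
    StrictMonoOn u.pendant (Icc 0 ℓ) ∧ IsLeast (u.pendant '' Icc 0 ℓ) (F ℓ) ∧
      IsGreatest (range u.line) (F ℓ) := by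
  have hℓ := h.length_pos
  have hτ := hF.pos ℓ hℓ.le
  -- A value on the line above the threshold would make the strip up to it doubly crossed.
  have hline : ∀ x, u.line x ≤ F ℓ := by
    intro x
    by_contra! hx
    refine hno (F ℓ) (u.line x) le_rfl hx (h.line_le_supValue x) fun a b ha hab hb => ?_
    exact h.stripBound_two_of_line (hτ.trans_le ha) hab fun t ht => ⟨x, ht.trans_le hb⟩
  -- The line misses {u > F ℓ}, whose length is ℓ, so this set fills the pendant up to a null set;
  -- continuity removes the exception.
  have hpend : ∀ x ∈ Icc 0 ℓ, F ℓ ≤ u.pendant x := by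
    have hvol := hF.levelMeasure_Ioi_threshold h
    rw [h.slope.levelMeasure_apply measurableSet_Ioi,
      show u.line ⁻¹' Ioi (F ℓ) = ∅ from
        eq_empty_of_forall_notMem fun x hx => (hline x).not_gt hx,
      measure_empty, zero_add] at hvol
    have hS : MeasurableSet (u.pendant ⁻¹' Ioi (F ℓ)) :=
      h.slope.pendant.continuous.measurable measurableSet_Ioi
    have hsplit := measure_inter_add_sdiff (μ := volume) (Icc 0 ℓ) hS
    rw [hvol, Real.volume_Icc, sub_zero] at hsplit
    have hnull : volume (Icc 0 ℓ \ u.pendant ⁻¹' Ioi (F ℓ)) = 0 := by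
      exact (ENNReal.add_right_inj ENNReal.ofReal_ne_top).1 (hsplit.trans (add_zero _).symm)
    have hae : u.pendant =ᵐ[volume.restrict (Icc 0 ℓ)] fun x => max (u.pendant x) (F ℓ) := by
      rw [Filter.EventuallyEq, ae_restrict_iff' measurableSet_Icc]
      filter_upwards [compl_mem_ae_iff.2 hnull] with x hx hxI
      by_contra hne
      refine hx ⟨hxI, fun hlt => hne ?_⟩
      exact (max_eq_left (le_of_lt hlt)).symm
    have hEq := Measure.eqOn_Icc_of_ae_eq volume hℓ.ne hae
      h.slope.pendant.continuous.continuousOn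
      (h.slope.pendant.continuous.max continuous_const).continuousOn
    exact fun x hx => (le_max_right _ _).trans_eq (hEq hx).symm
  have hz : (0 : ℝ) ∈ Icc 0 ℓ := left_mem_Icc.2 hℓ.le
  have hp0 : u.pendant 0 = F ℓ :=
    le_antisymm (h.slope.junction ▸ hline 0) (hpend 0 hz)
  -- The pendant starts at the minimum F ℓ, so a later descent creates a strip crossed once upwards
  -- and once downwards.
  have hmono : ∀ x ∈ Icc 0 ℓ, ∀ y ∈ Icc 0 ℓ, x ≤ y → u.pendant x ≤ u.pendant y := by
    intro x hx y hy hxy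
    by_contra! hlt
    refine hno _ _ (hpend y hy) hlt (h.pendant_le_supValue hx) fun a b ha hab hb => ?_
    exact h.stripBound_two_of_pendant (hτ.trans_le ((hpend y hy).trans ha)) hab hx.1 hxy hy.2
      ((hp0.trans_le (hpend y hy)).trans ha) hb ha
  refine ⟨fun x hx y hy hxy => lt_of_le_of_ne (hmono x hx y hy hxy.le) fun heq => ?_,
    ⟨⟨0, hz, hp0⟩, ?_⟩, ⟨⟨0, h.slope.junction.trans hp0⟩, ?_⟩⟩
  -- Equal values at x < y would make the pendant constant on [x, y], a level set of positive
  -- length.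
  · have hnull := h.level_null (u.pendant x) (h.pendant_pos x hx)
    rw [h.slope.levelMeasure_apply (measurableSet_singleton _), add_eq_zero] at hnull
    have hsub : Icc x y ⊆ Icc 0 ℓ ∩ u.pendant ⁻¹' {u.pendant x} := fun z hz' => by
      have hzI : z ∈ Icc 0 ℓ := ⟨hx.1.trans hz'.1, hz'.2.trans hy.2⟩
      exact ⟨hzI, le_antisymm ((hmono z hzI y hy hz'.2).trans_eq heq.symm)
        (hmono x hx z hzI hz'.1)⟩
    have := measure_mono_null hsub hnull.2
    rw [Real.volume_Icc, ENNReal.ofReal_eq_zero] at this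
    linarith
  · rintro _ ⟨x, hx, rfl⟩
    exact hpend x hx
  · rintro _ ⟨x, rfl⟩
    exact hline x

end IsDecreasingRearrangement

end PendantFun

namespace PendantFun

theorem InH1.posMeasurable {ℓ : ℝ} {u : PendantFun} (hu : u.InH1 ℓ) (hpos : u.Pos ℓ) :
    PosMeasurable ℓ u :=
  ⟨hu.continuous_line.measurable.aemeasurable,
    hu.continuousOn_pendant.aemeasurable measurableSet_Icc, hpos⟩

end PendantFun

/-! ### Assembly of the theorem. -/

open PendantFun in
theorem mainTheorem6 (ℓ μ p : ℝ) (hℓ : 0 < ℓ) (hμ : 0 < μ) (hp : 2 < p) (hp6 : p < 6)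
    (u : PendantFun) (hu : u.InH1Mass ℓ μ) (hpos : u.Pos ℓ)
    (hlevel : ∀ t : ℝ, 0 < t → u.meas ℓ {t} = 0) :
    ∃ v : PendantFun, v.InH1Mass ℓ μ ∧
      -- the line part is even and radially decreasing
      (∀ x, v.line (-x) = v.line x) ∧ StrictAntiOn v.line (Ici 0) ∧
      -- the pendant part is increasing; its minimum is the maximum of the line part
      StrictMonoOn v.pendant (Icc 0 ℓ) ∧
      IsLeast (v.pendant '' Icc 0 ℓ) (v.pendant 0) ∧
      v.pendant 0 = v.line 0 ∧
      IsGreatest (range v.line) (v.line 0) ∧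
      -- the values of `u` above a threshold `τ` are rearranged on the pendant,
      -- the values of `u` below `τ` on the line
      (∃ τ : ℝ, 0 < τ ∧ u.meas ℓ (Ioi τ) = ENNReal.ofReal ℓ ∧
        (∀ t : ℝ, τ ≤ t → volume {x ∈ Icc 0 ℓ | t < v.pendant x} = u.meas ℓ (Ioi t)) ∧
        (∀ t : ℝ, 0 < t → t < τ → volume {x | t < v.line x} = u.meas ℓ (Ioc t τ))) ∧
      -- the energy does not increase, and the case of equality
      v.energy p ℓ ≤ u.energy p ℓ ∧
      (v.energy p ℓ = u.energy p ℓ →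
        StrictMonoOn u.pendant (Icc 0 ℓ) ∧
        ∃ c : ℝ, IsLeast (u.pendant '' Icc 0 ℓ) c ∧ IsGreatest (range u.line) c) := by
  obtain ⟨hH, hmass⟩ := hu
  have hpm := hH.posMeasurable hpos
  obtain ⟨U, w, hUl, hUp, hs⟩ := hH.exists_hasSlope hℓ
  have hlev : u.levelMeasure ℓ = U.levelMeasure ℓ := levelMeasure_congr hUl hUp
  have hmeas : ∀ {S : Set ℝ}, MeasurableSet S → u.meas ℓ S = U.levelMeasure ℓ S := fun hS => by
    rw [← hlev, levelMeasure_apply hH.continuous_line.measurable hpm.pendant hS]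
  have h2 : ∫⁻ t, ENNReal.ofReal (t ^ (2 : ℝ)) ∂(u.levelMeasure ℓ) ≠ ⊤ :=
    hpm.memLp_iff.2 ⟨by simpa using hH.memH1_line.1, hH.memH1_pendant.1⟩
  have hR : Rearrangeable ℓ U w := by
    refine ⟨hℓ, hs, fun x => hUl ▸ hpos.1 x, fun x hx => hUp hx ▸ hpos.2 x hx, fun t ht => ?_,
      fun t ht => ?_⟩
    · exact hlev ▸ levelMeasure_Ioi_ne_top h2 ht
    · rw [← hmeas (measurableSet_singleton t), hlevel t ht]
  obtain ⟨F, hF⟩ := hR.exists_isDecreasingRearrangement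
  have hA := hF.strictAntiOn hR
  have hτ := hF.pos ℓ hℓ.le
  obtain ⟨hvl, hvE⟩ := hF.isPrimitive_line hR
  obtain ⟨ψ, k, hvp, hvpe, hvpE⟩ := hF.exists_isPrimitive_pendant hR
  have hvc : ContinuousOn (hybrid ℓ F).pendant (Icc 0 ℓ) := hvp.continuous.continuousOn.congr hvpe
  have hv0 : (hybrid ℓ F).pendant 0 = F ℓ := congrArg F (sub_zero ℓ)
  have hv0' : (hybrid ℓ F).line 0 = F ℓ := congrArg F (by simp)
  have hvm : PosMeasurable ℓ (hybrid ℓ F) :=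
    ⟨hvl.continuous.measurable.aemeasurable, hvc.aemeasurable measurableSet_Icc,
      fun x => hF.pos _ (by positivity), fun x hx => hF.pos _ (sub_nonneg.2 hx.2)⟩
  have hlint : ∀ q : ℝ, 0 < q → ∫⁻ t, ENNReal.ofReal (t ^ q) ∂((hybrid ℓ F).levelMeasure ℓ) =
      ∫⁻ t, ENNReal.ofReal (t ^ q) ∂(u.levelMeasure ℓ) := fun q hq =>
    lintegral_rpow_congr_of_measure_Ioi hvm.ae_nonneg hpm.ae_nonneg
      (fun t ht => by rw [hF.levelMeasure_hybrid hR hvm ht, hlev]) hq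
  have hv2 : ∫⁻ t, ENNReal.ofReal (t ^ (2 : ℝ)) ∂((hybrid ℓ F).levelMeasure ℓ) ≠ ⊤ := by
    rwa [hlint 2 two_pos]
  have hup : ∫⁻ t, ENNReal.ofReal (t ^ p) ∂(u.levelMeasure ℓ) ≠ ⊤ := by
    refine hpm.lintegral_rpow_ne_top (M := U.supValue ℓ) hp ?_ h2
    rw [ae_iff, hlev]
    exact (congrArg _ (by ext; simp)).trans (hR.levelMeasure_Ioi_eq_zero le_rfl)
  have hvp' : ∫⁻ t, ENNReal.ofReal (t ^ p) ∂((hybrid ℓ F).levelMeasure ℓ) ≠ ⊤ := by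
    rwa [hlint p (by linarith)]
  have huE := energy_eq_of_isPrimitive hpm (hUl ▸ hs.line) hs.pendant hUp hup
  have hvEn := energy_eq_of_isPrimitive hvm hvl hvp hvpe hvp'
  rw [hvpE, hlint p (by linarith)] at hvEn
  -- The total mass of the energy measure is the kinetic energy of u. Its parts above and below the
  -- threshold bound those of the new pendant and line.
  have hK := hs.energyMeasure_real (ℓ := ℓ) MeasurableSet.univ
  rw [preimage_univ, preimage_univ, inter_univ, setIntegral_univ,
    integral_Icc_eq_integral_Ioo] at hK
  have hmono : StrictMonoOn (hybrid ℓ F).pendant (Icc 0 ℓ) := fun x hx y hy hxy =>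
    hA (sub_nonneg.2 hy.2) (sub_nonneg.2 hx.2) (sub_lt_sub_left hxy ℓ)
  have hlineA : ∀ x y : ℝ, |x| < |y| → (hybrid ℓ F).line y < (hybrid ℓ F).line x :=
    fun x y hxy => hA (show 0 ≤ ℓ + 2 * |x| by positivity) (show 0 ≤ ℓ + 2 * |y| by positivity)
      (by linarith)
  have hle := hF.integral_sq_pendant_le hR
  refine ⟨hybrid ℓ F, ⟨⟨hvl.continuous, hvc, hv0'.trans hv0.symm, ?_, ?_⟩, ?_⟩, ?_, ?_, hmono, ?_,
    hv0.trans hv0'.symm, ?_, ⟨F ℓ, hτ, ?_, ?_, ?_⟩, ?_, ?_⟩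
  · exact hvl.memH1 isOpen_univ (fun _ _ => rfl) ((hvm.memLp_iff.1 hv2).1.restrict univ)
  · exact hvp.memH1 isOpen_Ioo (hvpe.mono Ioo_subset_Icc_self) (hvm.memLp_iff.1 hv2).2
  · rw [mass_eq, hvm.integral_rpow hv2, hlint 2 two_pos, ← hpm.integral_rpow h2, ← mass_eq, hmass]
  · exact fun x => by simp only [hybrid, abs_neg]
  · intro x hx y hy hxy
    exact hlineA x y (by rwa [abs_of_nonneg hx, abs_of_nonneg hy])
  · refine ⟨⟨0, left_mem_Icc.2 hℓ.le, rfl⟩, ?_⟩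
    rintro _ ⟨x, hx, rfl⟩
    exact hmono.monotoneOn (left_mem_Icc.2 hℓ.le) hx hx.1
  · refine ⟨⟨0, rfl⟩, ?_⟩
    rintro _ ⟨x, rfl⟩
    rcases eq_or_ne x 0 with rfl | hx
    · exact le_rfl
    · exact (hlineA 0 x (by rw [abs_zero]; exact abs_pos.2 hx)).le
  · rw [hmeas measurableSet_Ioi, hF.levelMeasure_Ioi_threshold hR]
  · intro t ht
    rw [hmeas measurableSet_Ioi]
    exact hF.volume_pendant hR ht
  · intro t h0 ht
    rw [hmeas measurableSet_Ioc]
    exact hF.volume_line hR h0 ht.le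
  · rw [huE, hvEn]
    linarith
  · intro heq
    rw [huE, hvEn] at heq
    obtain ⟨hm, hl, hg⟩ := hF.structure_of_not_stripBound hR fun t₁ t₂ h1 h12 h2 hk => by
      have := hF.integral_sq_pendant_lt hR h1 h12 h2 hk
      linarith
    refine ⟨hm.congr hUp.symm, F ℓ, ?_, hUl ▸ hg⟩
    rwa [hUp.image_eq]
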